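/- **Definitions.** An idempotent semiring $S=(S,\vee,\cdot,\bot,1)$ and an idempotent commutative monoid $V=(V,\vee,\bot)$ are ordered by $x\le y \iff x\vee y=y$, and $\bigvee$ denotes the least upper bound in this order. A *$^*$-continuous Kleene algebra* is an idempotent semiring with a unary operation $^*$ such that $x y^* z=\bigvee_{n\ge 0}x y^n z$ for all $x,y,z\in S$ (in particular, $y^*=\bigvee_{n\ge0}y^n$). A sequence $x_0,x_1,\dots$ in $S$ is *finitary* if there is a finite set $F\subseteq S$ such that each $x_n$ is a finite product of elements of $F$. A *finitary $^*$-continuous Kleene $\omega$-algebra* $(S,V)$ consists of a $^*$-continuous Kleene algebra $S$, a unitary left $S$-semimodule $V=(V,\vee,\bot)$ (necessarily idempotent), and an infinite product assigning to each finitary sequence $(x_n)_{n\ge0}$ over $S$ an element $\prod_{n\ge0}x_n\in V$, such that: * $x y^* v=\bigvee_{n\ge0}x y^n v$ for all $x,y\in S$, $v\in V$; * $\prod_{n\ge0}x_n=x_0\prod_{n\ge0}x_{n+1}$ for every finitary $(x_n)$; * $\prod_{n\ge0}x_n=\prod_{k\ge0}(x_{i_k}\cdots x_{i_{k+1}-1})$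 for every finitary $(x_n)$ and all integers $0=i_0\le i_1\le\cdots$ increasing without bound (an empty product is $1$); * $\prod_{n\ge0}x_n(y\vee z)=\bigvee_{x_n'\in\{y,z\}}\prod_{n\ge0}x_nx_n'$ for every finitary $(x_n)$ and all $y,z\in S$; * $\prod_{n\ge0}x^*y_n=\bigvee_{k_0,k_1,\ldots\ge0}\prod_{n\ge0}x^{k_n}y_n$ for all $x\in S$ and every finitary $(y_n)$. A *homomorphism* $(S,V)\to(S',V')$ is a pair of maps $h_S:S\to S'$, $h_V:V\to V'$ that together preserve all operations: $\vee,\bot,\cdot,1,{}^*$ on $S$, $\vee,\bot$ on $V$, the action, and infinite products of finitary sequences. For a set $A$ (possibly infinite), let $A^*$ be the set of finite words, $A^\omega$ the set of $\omega$-words and $A^\infty=A^*\cup A^\omega$. Let $R(A^*)$ be the set of regular languages over $A$, i.e. the languages obtained from $\emptyset$, $\{\epsilon\}$ and the $\{a\}$, $a\in A$, by finitely many unions, concatenations and Kleene stars, with these operations. For $X_0,X_1,\ldots\subseteq A^*$ let $\prod_{n\ge0}X_n=\{u_0u_1u_2\cdots : u_n\in X_n\}\subseteq A^\infty$ (such a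 word is finite iff all but finitely many $u_n$ are empty). Let $R'(A^\infty)$ be the collection of all finite unions of sets $\prod_{n\ge0}R_n$ where every $R_n\subseteq A^*$ is regular and $\{R_0,R_1,\dots\}$ is a finite set of languages. It is equipped with union, the empty set, the action of $R(A^*)$ by concatenation, and the infinite product above of finitary sequences over $R(A^*)$. **Theorem.** For every set $A$, $(R(A^*),R'(A^\infty))$ is the free finitary $^*$-continuous Kleene $\omega$-algebra, freely generated by $A$. That is, it is a finitary $^*$-continuous Kleene $\omega$-algebra, and for every finitary $^*$-continuous Kleene $\omega$-algebra $(S,V)$ and every map $h:A\to S$ there is a unique homomorphism $(h_S,h_V):(R(A^*),R'(A^\infty))\to(S,V)$ with $h_S(\{a\})=h(a)$ for all $a\in A$. -/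

import Mathlib

open Computability

namespace KleeneOmega

universe u v w

/-! ## Finitary sequences and finitary infinite products -/

section Finitary

/-- A sequence over `S` is finitary if there is a finite set `F` such that every member of the
sequence is a finite product of elements of `F`. -/
def IsFinitary {S : Type v} [Monoid S] (x : ℕ → S) : Prop :=
  ∃ F : Set S, F.Finite ∧ ∀ n, ∃ l : List S, (∀ y ∈ l, y ∈ F) ∧ l.prod = x n

theorem isFinitary_iff {S : Type v} [Monoid S] (x : ℕ → S) :
    IsFinitary x ↔ ∃ F : Set S, F.Finite ∧ ∀ n, x n ∈ Submonoid.closure F := by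
  constructor
  · rintro ⟨F, hF, h⟩
    refine ⟨F, hF, fun n => ?_⟩
    obtain ⟨l, hl, e⟩ := h n
    exact e ▸ Submonoid.list_prod_mem _ fun y hy => Submonoid.subset_closure (hl y hy)
  · rintro ⟨F, hF, h⟩
    exact ⟨F, hF, fun n => Submonoid.exists_list_of_mem_closure (h n)⟩

theorem IsFinitary.mul {S : Type v} [Monoid S] {x y : ℕ → S} (hx : IsFinitary x)
    (hy : IsFinitary y) : IsFinitary (fun n => x n * y n) := by
  rw [isFinitary_iff] at *
  obtain ⟨F, hF, hx⟩ := hx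
  obtain ⟨G, hG, hy⟩ := hy
  exact ⟨F ∪ G, hF.union hG, fun n => mul_mem
    (Submonoid.closure_mono Set.subset_union_left (hx n))
    (Submonoid.closure_mono Set.subset_union_right (hy n))⟩

theorem IsFinitary.of_finite {S : Type v} [Monoid S] {x : ℕ → S} (F : Set S) (hF : F.Finite)
    (h : ∀ n, x n ∈ F) : IsFinitary x :=
  (isFinitary_iff x).2 ⟨F, hF, fun n => Submonoid.subset_closure (h n)⟩

theorem IsFinitary.const {S : Type v} [Monoid S] (x : S) : IsFinitary (fun _ => x) :=
  .of_finite {x} (Set.finite_singleton x) fun _ => rfl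

theorem IsFinitary.of_pair {S : Type v} [Monoid S] {x : ℕ → S} {y z : S}
    (h : ∀ n, x n = y ∨ x n = z) : IsFinitary x :=
  .of_finite {y, z} (Set.toFinite _) h

theorem IsFinitary.powers {S : Type v} [Monoid S] (x : S) (k : ℕ → ℕ) :
    IsFinitary (fun n => x ^ k n) :=
  (isFinitary_iff _).2 ⟨{x}, Set.finite_singleton x, fun n =>
    pow_mem (Submonoid.subset_closure (Set.mem_singleton x)) (k n)⟩

theorem IsFinitary.tail {S : Type v} [Monoid S] {x : ℕ → S} (hx : IsFinitary x) :
    IsFinitary (fun n => x (n + 1)) := by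
  obtain ⟨F, hF, h⟩ := hx
  exact ⟨F, hF, fun n => h (n + 1)⟩

theorem IsFinitary.map {S : Type v} {T : Type w} [Monoid S] [Monoid T] {x : ℕ → S}
    (hx : IsFinitary x) (f : S →* T) : IsFinitary (fun n => f (x n)) := by
  obtain ⟨F, hF, h⟩ := hx
  refine ⟨f '' F, hF.image f, fun n => ?_⟩
  obtain ⟨l, hl, e⟩ := h n
  refine ⟨l.map f, ?_, (map_list_prod f l).symm.trans (congrArg f e)⟩
  intro y hy
  obtain ⟨z, hz, rfl⟩ := List.mem_map.1 hy
  exact ⟨z, hl z hz, rfl⟩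

/-- `blockProd x i j` is the product `x i * x (i + 1) * ⋯ * x (j - 1)`, which is `1` if `j ≤ i`. -/
def blockProd {S : Type v} [Monoid S] (x : ℕ → S) (i j : ℕ) : S :=
  ((List.range' i (j - i)).map x).prod

theorem IsFinitary.block {S : Type v} [Monoid S] {x : ℕ → S} (hx : IsFinitary x) (i : ℕ → ℕ) :
    IsFinitary (fun k => blockProd x (i k) (i (k + 1))) := by
  rw [isFinitary_iff] at *
  obtain ⟨F, hF, h⟩ := hx
  refine ⟨F, hF, fun n => Submonoid.list_prod_mem _ fun y hy => ?_⟩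
  obtain ⟨m, -, rfl⟩ := List.mem_map.1 hy
  exact h m

/-- An infinite product operation, defined exactly on the finitary sequences over `S`, with values
in `V`. -/
class FinitaryProd (S : Type v) (V : Type w) [Monoid S] where
  /-- the infinite product of a finitary sequence -/
  prod : (x : ℕ → S) → IsFinitary x → V

end Finitary

/-! ## Finitary `*`-continuous Kleene `ω`-algebras and their homomorphisms -/

open FinitaryProd in
/-- A finitary `*`-continuous Kleene `ω`-algebra `(S, V)`: a Kleene algebra `S` acting on a
semimodule `V`, together with an infinite product of finitary sequences.

Mathlib's `KleeneAlgebra S` is an idempotent semiring, ordered by its natural order, with a star;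
`star_continuous` is `*`-continuity of `S`. `Module S V` says that `V` is a unitary left
`S`-semimodule, and `le_iff_add_eq` that the order of `V` is the natural one. -/
class FinStarContKleeneOmegaAlgebra (S : Type v) (V : Type w) [KleeneAlgebra S]
    [AddCommMonoid V] [PartialOrder V] [Module S V] [FinitaryProd S V] : Prop where
  star_continuous : ∀ x y z : S, IsLUB (Set.range fun n : ℕ => x * y ^ n * z) (x * y∗ * z)
  le_iff_add_eq : ∀ v v' : V, v ≤ v' ↔ v + v' = v'
  star_smul : ∀ (x y : S) (v : V),
    IsLUB (Set.range fun n : ℕ => (x * y ^ n) • v) ((x * y∗) • v)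
  prod_cons : ∀ (x : ℕ → S) (hx : IsFinitary x),
    (prod x hx : V) = x 0 • prod (fun n => x (n + 1)) hx.tail
  prod_block : ∀ (x : ℕ → S) (hx : IsFinitary x) (i : ℕ → ℕ), i 0 = 0 → Monotone i →
    (∀ N, ∃ k, N ≤ i k) →
    (prod x hx : V) = prod (fun k => blockProd x (i k) (i (k + 1))) (hx.block i)
  prod_add : ∀ (x : ℕ → S) (hx : IsFinitary x) (y z : S),
    IsLUB
      (Set.range fun c : {c : ℕ → S // ∀ n, c n = y ∨ c n = z} =>
        (prod (fun n => x n * c.1 n) (hx.mul (.of_pair c.2)) : V))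
      (prod (fun n => x n * (y + z)) (hx.mul (.const (y + z))))
  prod_star : ∀ (x : S) (y : ℕ → S) (hy : IsFinitary y),
    IsLUB
      (Set.range fun k : ℕ → ℕ =>
        (prod (fun n => x ^ k n * y n) ((IsFinitary.powers x k).mul hy) : V))
      (prod (fun n => x∗ * y n) ((IsFinitary.const x∗).mul hy))

/-- A homomorphism `(S, V) → (S', V')` of finitary `*`-continuous Kleene `ω`-algebras: a pair of
maps preserving all operations. -/
structure Hom (S : Type*) (V : Type*) (S' : Type*) (V' : Type*)
    [KleeneAlgebra S] [AddCommMonoid V] [Module S V] [FinitaryProd S V]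
    [KleeneAlgebra S'] [AddCommMonoid V'] [Module S' V'] [FinitaryProd S' V'] where
  /-- the map on the Kleene algebras -/
  onS : S →+* S'
  /-- the map on the semimodules -/
  onV : V →+ V'
  map_kstar : ∀ x : S, onS x∗ = (onS x)∗
  map_smul : ∀ (x : S) (v : V), onV (x • v) = onS x • onV v
  map_prod : ∀ (x : ℕ → S) (hx : IsFinitary x),
    onV (FinitaryProd.prod x hx) =
      FinitaryProd.prod (fun n => onS (x n)) (hx.map (onS : S →* S'))

/-! ## Regular languages -/

section Regular

variable {A : Type u}

/-- The regular languages over a (possibly infinite) set `A`: those obtained from the empty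
language, `{ε}` and the languages `{a}` by finitely many unions, concatenations and stars. They
form a subsemiring of the semiring of all languages. -/
def regular (A : Type u) : Subsemiring (Language A) where
  carrier := {L | ∃ P : RegularExpression A, P.matches' = L}
  zero_mem' := ⟨0, rfl⟩
  one_mem' := ⟨1, rfl⟩
  add_mem' := by rintro _ _ ⟨P, rfl⟩ ⟨Q, rfl⟩; exact ⟨P + Q, rfl⟩
  mul_mem' := by rintro _ _ ⟨P, rfl⟩ ⟨Q, rfl⟩; exact ⟨P * Q, rfl⟩

/-- `R(A*)`, the set of regular languages over `A`. -/
abbrev RegLang (A : Type u) : Type u := regular A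

instance : KStar (RegLang A) where
  kstar X := ⟨X.1∗, by obtain ⟨P, hP⟩ := X.2; exact ⟨P.star, hP ▸ rfl⟩⟩

/-- `R(A*)` with union, concatenation and Kleene star, ordered by inclusion. -/
instance : KleeneAlgebra (RegLang A) where
  __ := (inferInstance : Semiring (RegLang A))
  __ := (inferInstance : PartialOrder (RegLang A))
  __ := (inferInstance : KStar (RegLang A))
  sup X Y := X + Y
  le_sup_left X Y := (le_sup_left : X.1 ≤ X.1 ⊔ Y.1)
  le_sup_right X Y := (le_sup_right : Y.1 ≤ X.1 ⊔ Y.1)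
  sup_le X Y Z h h' := (sup_le h h' : X.1 ⊔ Y.1 ≤ Z.1)
  bot := 0
  bot_le X := (bot_le : ⊥ ≤ X.1)
  add_eq_sup _ _ := rfl
  one_le_kstar X := (one_le_kstar : 1 ≤ X.1∗)
  mul_kstar_le_kstar X := (mul_kstar_le_kstar : X.1 * X.1∗ ≤ X.1∗)
  kstar_mul_le_kstar X := (kstar_mul_le_kstar : X.1∗ * X.1 ≤ X.1∗)
  mul_kstar_le_self X Y h := (mul_kstar_le_self h : Y.1 * X.1∗ ≤ Y.1)
  kstar_mul_le_self X Y h := (kstar_mul_le_self h : X.1∗ * Y.1 ≤ Y.1)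

/-- The regular language `{a}` consisting of the one-letter word `a`. -/
def RegLang.letter (a : A) : RegLang A := ⟨{[a]}, .char a, rfl⟩

end Regular

/-! ## Finite and infinite words -/

section Words

variable {A : Type u}

/-- `A^∞`, the set of all finite words and all `ω`-words over `A`. -/
abbrev InfWord (A : Type u) : Type u := List A ⊕ Stream' A

/-- Concatenation of a finite word with a word in `A^∞`. -/
def append (x : List A) : InfWord A → InfWord A
  | .inl y => .inl (x ++ y)
  | .inr s => .inr (x ++ₛ s)

/-- The word `u 0 u 1 ⋯ u (n - 1)`. -/
def partialConcat (u : ℕ → List A) (n : ℕ) : List A := ((List.range n).map u).flatten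

/-- `IsLimit p w`: the finite words `p 0, p 1, …`, each a prefix of the next one in all our uses,
converge to `w`. For a finite word `w` this means that they are eventually equal to `w`, and for an
`ω`-word `w` that they are prefixes of `w` of unbounded length. -/
def IsLimit (p : ℕ → List A) : InfWord A → Prop
  | .inl l => ∃ N, ∀ n, N ≤ n → p n = l
  | .inr s => (∀ n, ∃ t : Stream' A, p n ++ₛ t = s) ∧ ∀ m, ∃ n, m ≤ (p n).length

/-- `infProd X` is the set of all words `u 0 u 1 u 2 ⋯` in `A^∞` with `u n ∈ X n` for all `n`. -/
def infProd (X : ℕ → Language A) : Set (InfWord A) :=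
  {w | ∃ u : ℕ → List A, (∀ n, u n ∈ X n) ∧ IsLimit (partialConcat u) w}

/-- The action of languages of finite words on subsets of `A^∞`: all `x y` with `x ∈ X`, `y ∈ Y`. -/
def act (X : Language A) (Y : Set (InfWord A)) : Set (InfWord A) :=
  {w | ∃ x ∈ X, ∃ y ∈ Y, append x y = w}

/-- Finite unions of sets `∏ R n`, where every `R n` is a regular language and the set
`{R 0, R 1, …}` is finite. -/
def IsRegInf (Y : Set (InfWord A)) : Prop :=
  ∃ (k : ℕ) (R : Fin k → ℕ → Language A),
    (∀ j n, R j n ∈ regular A) ∧ (∀ j, (Set.range (R j)).Finite) ∧ Y = ⋃ j, infProd (R j)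

/-- `R'(A^∞)`. -/
def RegInf (A : Type u) : Type u := {Y : Set (InfWord A) // IsRegInf Y}

/-! ### Facts needed to equip `R'(A^∞)` with its operations -/

theorem append_append (x y : List A) (w : InfWord A) :
    append (x ++ y) w = append x (append y w) := by
  cases w <;> simp [append, Stream'.append_append_stream]

theorem append_nil (w : InfWord A) : append [] w = w := by
  cases w <;> simp [append]

theorem appendStream_cancel (x : List A) {s t : Stream' A} (h : x ++ₛ s = x ++ₛ t) : s = t := by
  rw [← Stream'.drop_append_stream x s, h, Stream'.drop_append_stream]

theorem partialConcat_succ (u : ℕ → List A) (n : ℕ) :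
    partialConcat u (n + 1) = partialConcat u n ++ u n := by
  simp [partialConcat, List.range_succ]

theorem partialConcat_prefix (u : ℕ → List A) {m n : ℕ} (h : m ≤ n) :
    partialConcat u m <+: partialConcat u n := by
  induction n, h using Nat.le_induction with
  | base => exact List.prefix_rfl
  | succ n _ ih => exact ih.trans (partialConcat_succ u n ▸ List.prefix_append _ _)

theorem isLimit_subseq (u : ℕ → List A) (f : ℕ → ℕ) (hf : ∀ n, n ≤ f n) (w : InfWord A) :
    IsLimit (fun n => partialConcat u (f n)) w ↔ IsLimit (partialConcat u) w := by
  cases w with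
  | inl l =>
    constructor
    · rintro ⟨N, h⟩
      refine ⟨f N, fun n hn => ?_⟩
      have h1 := partialConcat_prefix u hn
      have h2 := partialConcat_prefix u (hf n)
      have h3 : partialConcat u (f N) = l := h N le_rfl
      have h4 : partialConcat u (f n) = l := h n ((hf N).trans hn)
      rw [h3] at h1
      rw [h4] at h2
      exact h2.eq_of_length (le_antisymm h2.length_le h1.length_le)
    · rintro ⟨N, h⟩
      exact ⟨N, fun n hn => h _ (hn.trans (hf n))⟩
  | inr s =>
    constructor
    · rintro ⟨h, h'⟩
      refine ⟨fun n => ?_, fun m => ?_⟩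
      · obtain ⟨t, ht⟩ := h n
        obtain ⟨r, hr⟩ := partialConcat_prefix u (hf n)
        refine ⟨r ++ₛ t, ?_⟩
        rw [← ht, ← Stream'.append_append_stream, hr]
      · obtain ⟨n, hn⟩ := h' m
        exact ⟨f n, hn⟩
    · rintro ⟨h, h'⟩
      refine ⟨fun n => h _, fun m => ?_⟩
      obtain ⟨n, hn⟩ := h' m
      exact ⟨n, hn.trans (partialConcat_prefix u (hf n)).length_le⟩

theorem isLimit_append (x : List A) (p : ℕ → List A) (w' : InfWord A) :
    IsLimit (fun n => x ++ p n) w' ↔ ∃ w, IsLimit p w ∧ append x w = w' := by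
  constructor
  · cases w' with
    | inl l =>
      rintro ⟨N, h⟩
      refine ⟨.inl (p N), ⟨N, fun n hn => ?_⟩, congrArg Sum.inl (h N le_rfl)⟩
      exact List.append_cancel_left ((h n hn).trans (h N le_rfl).symm)
    | inr s =>
      rintro ⟨h, h'⟩
      obtain ⟨t, ht⟩ := h 0
      simp only [Stream'.append_append_stream] at ht h
      refine ⟨.inr (p 0 ++ₛ t), ⟨fun n => ?_, fun m => ?_⟩, congrArg Sum.inr ht⟩
      · obtain ⟨r, hr⟩ := h n
        exact ⟨r, appendStream_cancel x (hr.trans ht.symm)⟩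
      · obtain ⟨n, hn⟩ := h' (x.length + m)
        rw [List.length_append] at hn
        exact ⟨n, by omega⟩
  · rintro ⟨w, hw, rfl⟩
    cases w with
    | inl l =>
      obtain ⟨N, h⟩ := hw
      exact ⟨N, fun n hn => by simp only [h n hn]⟩
    | inr s =>
      obtain ⟨h, h'⟩ := hw
      refine ⟨fun n => ?_, fun m => ?_⟩
      · obtain ⟨t, ht⟩ := h n
        exact ⟨t, by rw [Stream'.append_append_stream, ht]⟩
      · obtain ⟨n, hn⟩ := h' m
        exact ⟨n, by rw [List.length_append]; omega⟩

theorem partialConcat_succ' (u : ℕ → List A) (n : ℕ) :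
    partialConcat u (n + 1) = u 0 ++ partialConcat (fun m => u (m + 1)) n := by
  simp [partialConcat, List.range_succ_eq_map, Function.comp_def]

theorem isLimit_cons (u : ℕ → List A) (w' : InfWord A) :
    IsLimit (partialConcat u) w' ↔
      ∃ w, IsLimit (partialConcat fun n => u (n + 1)) w ∧ append (u 0) w = w' := by
  rw [← isLimit_subseq u (fun n => n + 1) (fun n => n.le_succ), ← isLimit_append]
  simp only [partialConcat_succ']

/-- Prepending a term to a sequence. -/
def consSeq {α : Type*} (x : α) (y : ℕ → α) : ℕ → α
  | 0 => x
  | n + 1 => y n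

theorem act_infProd (X : Language A) (R : ℕ → Language A) :
    act X (infProd R) = infProd (consSeq X R) := by
  ext w'
  constructor
  · rintro ⟨x, hx, w, ⟨u, hu, hw⟩, rfl⟩
    refine ⟨consSeq x u, ?_, (isLimit_cons _ _).2 ⟨w, hw, rfl⟩⟩
    rintro (_ | n)
    · exact hx
    · exact hu n
  · rintro ⟨u, hu, hw⟩
    obtain ⟨w, hw, h⟩ := (isLimit_cons _ _).1 hw
    exact ⟨u 0, hu 0, w, ⟨fun n => u (n + 1), fun n => hu (n + 1), hw⟩, h⟩

theorem isRegInf_empty : IsRegInf (∅ : Set (InfWord A)) :=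
  ⟨0, Fin.elim0, fun j => j.elim0, fun j => j.elim0, by simp⟩

theorem IsRegInf.union {Y Z : Set (InfWord A)} (hY : IsRegInf Y) (hZ : IsRegInf Z) :
    IsRegInf (Y ∪ Z) := by
  obtain ⟨k, R, h1, h2, rfl⟩ := hY
  obtain ⟨l, T, h3, h4, rfl⟩ := hZ
  refine ⟨k + l, Fin.append R T, fun j => ?_, fun j => ?_, ?_⟩
  · refine Fin.addCases (fun i => ?_) (fun i => ?_) j
    · simpa using h1 i
    · simpa using h3 i
  · refine Fin.addCases (fun i => ?_) (fun i => ?_) j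
    · simpa using h2 i
    · simpa using h4 i
  · ext w
    simp only [Set.mem_union, Set.mem_iUnion]
    constructor
    · rintro (⟨i, hi⟩ | ⟨i, hi⟩)
      · exact ⟨Fin.castAdd l i, by simpa using hi⟩
      · exact ⟨Fin.natAdd k i, by simpa using hi⟩
    · rintro ⟨j, hj⟩
      revert hj
      refine Fin.addCases (fun i => ?_) (fun i => ?_) j <;> intro hi
      · exact .inl ⟨i, by simpa using hi⟩
      · exact .inr ⟨i, by simpa using hi⟩

theorem IsRegInf.act {X : Language A} (hX : X ∈ regular A) {Y : Set (InfWord A)}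
    (hY : IsRegInf Y) : IsRegInf (act X Y) := by
  obtain ⟨k, R, h1, h2, rfl⟩ := hY
  refine ⟨k, fun j => consSeq X (R j), fun j n => ?_, fun j => ?_, ?_⟩
  · cases n with
    | zero => exact hX
    | succ n => exact h1 j n
  · refine ((h2 j).insert X).subset ?_
    rintro _ ⟨_ | n, rfl⟩
    · exact .inl rfl
    · exact .inr ⟨n, rfl⟩
  · simp only [← act_infProd]
    ext w
    simp only [KleeneOmega.act, Set.mem_iUnion, Set.mem_ofPred_eq]
    constructor
    · rintro ⟨x, hx, y, ⟨j, hy⟩, e⟩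
      exact ⟨j, x, hx, y, hy, e⟩
    · rintro ⟨j, x, hx, y, hy, e⟩
      exact ⟨x, hx, y, ⟨j, hy⟩, e⟩

/-- Total length of the first `k` lists of a sequence. -/
def offset {α : Type*} (l : ℕ → List α) : ℕ → ℕ
  | 0 => 0
  | k + 1 => offset l k + (l k).length

theorem offset_congr {α β : Type*} {l : ℕ → List α} {c : ℕ → List β}
    (h : ∀ k, (l k).length = (c k).length) (k : ℕ) : offset l k = offset c k := by
  induction k with
  | zero => rfl
  | succ k ih => simp only [offset, ih, h]

/-- For lists of words, the concatenations of blocks have the same partial concatenations, at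
the offsets, as a sequence that lists the words one after the other. -/
theorem partialConcat_offset (c : ℕ → List (List A)) (u : ℕ → List A)
    (h : ∀ k, c k = (List.range' (offset c k) (c k).length).map u) (k : ℕ) :
    partialConcat u (offset c k) = partialConcat (fun k => (c k).flatten) k := by
  induction k with
  | zero => rfl
  | succ k ih =>
    rw [partialConcat_succ, ← ih, offset]
    conv_rhs => rw [h k]
    rw [partialConcat, partialConcat, ← List.flatten_append, ← List.map_append,
      List.range_eq_range', List.range_eq_range']
    congr 2
    have := List.range'_append (s := 0) (m := offset c k) (n := (c k).length) (step := 1)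
    simpa using this.symm

theorem le_offset {α : Type*} {l : ℕ → List α} (h : ∀ k, l k ≠ []) (k : ℕ) : k ≤ offset l k := by
  induction k with
  | zero => exact Nat.zero_le _
  | succ k ih =>
    have := List.length_pos_iff.2 (h k)
    simp only [offset]
    omega

/-- A sequence of nonempty lists can be listed as one sequence. -/
theorem exists_flat {α : Type*} (l : ℕ → List α) (h : ∀ k, l k ≠ []) :
    ∃ f : ℕ → α, (∀ k, l k = (List.range' (offset l k) (l k).length).map f) := by
  have hmono : Monotone (offset l) := monotone_nat_of_le_succ fun k => Nat.le_add_right _ _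
  have key : ∀ m, ∃ k, offset l k ≤ m ∧ m < offset l (k + 1) := by
    intro m
    induction m with
    | zero => exact ⟨0, le_rfl, by simpa [offset] using List.length_pos_iff.2 (h 0)⟩
    | succ m ih =>
      obtain ⟨k, h1, h2⟩ := ih
      by_cases hk : m + 1 < offset l (k + 1)
      · exact ⟨k, by omega, hk⟩
      · have := List.length_pos_iff.2 (h (k + 1))
        exact ⟨k + 1, by omega, by rw [offset]; omega⟩
  choose b hb1 hb2 using key
  have hb : ∀ k i, i < (l k).length → b (offset l k + i) = k := by
    intro k i hi
    have h1 := hb1 (offset l k + i)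
    have h2 := hb2 (offset l k + i)
    have h3 : offset l (k + 1) = offset l k + (l k).length := rfl
    by_contra hne
    rcases Nat.lt_or_gt_of_ne hne with hlt | hlt
    · have := hmono (Nat.succ_le_of_lt hlt)
      simp only [Nat.succ_eq_add_one] at this
      omega
    · have := hmono (Nat.succ_le_of_lt hlt)
      simp only [Nat.succ_eq_add_one] at this
      omega
  refine ⟨fun m => (l (b m))[m - offset l (b m)]'(by
    have h1 := hb1 m
    have h2 := hb2 m
    rw [offset] at h2
    omega), fun k => ?_⟩
  apply List.ext_getElem
  · simp
  · intro i h1 h2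
    simp only [List.getElem_map, List.getElem_range', one_mul]
    have e := hb k i h1
    generalize_proofs pf
    revert pf
    rw [e]
    intro pf
    congr 1
    omega

theorem mem_list_prod {L : List (Language A)} {x : List A} :
    x ∈ L.prod ↔ ∃ c : List (List A), List.Forall₂ (· ∈ ·) c L ∧ c.flatten = x := by
  induction L generalizing x with
  | nil => simp [eq_comm]
  | cons X L ih =>
    rw [List.prod_cons, Language.mem_mul]
    constructor
    · rintro ⟨a, ha, b, hb, rfl⟩
      obtain ⟨c, hc, rfl⟩ := ih.1 hb
      exact ⟨a :: c, .cons ha hc, rfl⟩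
    · rintro ⟨c, hc, rfl⟩
      cases hc with
      | cons ha hc => exact ⟨_, ha, _, ih.2 ⟨_, hc, rfl⟩, rfl⟩

theorem forall₂_map_iff (u : ℕ → List A) (Z : ℕ → Language A) (s : List ℕ) :
    List.Forall₂ (· ∈ ·) (s.map u) (s.map Z) ↔ ∀ m ∈ s, u m ∈ Z m := by
  simp [List.forall₂_map_left_iff, List.forall₂_map_right_iff, List.forall₂_same]

theorem infProd_flat (l : ℕ → List (Language A)) (h : ∀ k, l k ≠ []) (Z : ℕ → Language A)
    (hZ : ∀ k, l k = (List.range' (offset l k) (l k).length).map Z) :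
    infProd (fun k => (l k).prod) = infProd Z := by
  ext w
  constructor
  · rintro ⟨v, hv, hw⟩
    choose c hc hcv using fun k => mem_list_prod.1 (hv k)
    have hlen : ∀ k, (c k).length = (l k).length := fun k => (hc k).length_eq
    have hne : ∀ k, c k ≠ [] := fun k => by
      rw [← List.length_pos_iff, hlen, List.length_pos_iff]
      exact h k
    obtain ⟨u, hu⟩ := exists_flat c hne
    have hvc : v = fun k => (c k).flatten := funext fun k => (hcv k).symm
    refine ⟨u, fun n => ?_, ?_⟩
    · have hk : ∀ k, ∀ m ∈ List.range' (offset l k) (l k).length, u m ∈ Z m := by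
        intro k
        rw [← forall₂_map_iff, ← hZ k]
        have := hu k
        rw [offset_congr hlen, hlen] at this
        rw [← this]
        exact hc k
      have hcover : ∀ k, ∀ m < offset l k, u m ∈ Z m := by
        intro k
        induction k with
        | zero => intro m hm; exact absurd hm (Nat.not_lt_zero _)
        | succ k ih =>
          intro m hm
          by_cases hmk : m < offset l k
          · exact ih m hmk
          · refine hk k m (List.mem_range'_1.2 ⟨by omega, ?_⟩)
            simpa [offset] using hm
      exact hcover (n + 1) n (le_offset h (n + 1))
    · rw [← isLimit_subseq u (offset c) (le_offset hne)]
      simp only [partialConcat_offset c u hu]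
      rw [← hvc]
      exact hw
  · rintro ⟨u, hu, hw⟩
    let c : ℕ → List (List A) := fun k => (List.range' (offset l k) (l k).length).map u
    have hlen : ∀ k, (c k).length = (l k).length := fun k => by simp [c]
    have hc : ∀ k, c k = (List.range' (offset c k) (c k).length).map u := fun k => by
      rw [offset_congr hlen, hlen]
    have hne : ∀ k, c k ≠ [] := fun k => by
      rw [← List.length_pos_iff, hlen, List.length_pos_iff]
      exact h k
    refine ⟨fun k => (c k).flatten, fun k => mem_list_prod.2 ⟨c k, ?_, rfl⟩, ?_⟩
    · rw [hZ k]
      exact (forall₂_map_iff u Z _).2 fun m _ => hu m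
    · rw [← isLimit_subseq u (offset c) (le_offset hne)] at hw
      simp only [partialConcat_offset c u hc] at hw
      exact hw

theorem isRegInf_infProd {X : ℕ → RegLang A} (hX : IsFinitary X) :
    IsRegInf (infProd fun n => (X n).1) := by
  obtain ⟨F, hF, h⟩ := hX
  choose l hl e using h
  let L : ℕ → List (Language A) := fun k => 1 :: (l k).map Subtype.val
  have hne : ∀ k, L k ≠ [] := fun k => List.cons_ne_nil _ _
  obtain ⟨Z, hZ⟩ := exists_flat L hne
  have hprod : (fun n => (X n).1) = fun k => (L k).prod := by
    funext k
    rw [← e k]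
    simp only [L, List.prod_cons, one_mul]
    exact map_list_prod (regular A).subtype (l k)
  let G : Set (Language A) := insert 1 (Subtype.val '' F)
  have hG : ∀ k, ∀ Y ∈ L k, Y ∈ G := by
    intro k Y hY
    rcases List.mem_cons.1 hY with rfl | hY
    · exact .inl rfl
    · obtain ⟨Y', hY', rfl⟩ := List.mem_map.1 hY
      exact .inr ⟨Y', hl k Y' hY', rfl⟩
  have hcover : ∀ k, ∀ m < offset L k, Z m ∈ G := by
    intro k
    induction k with
    | zero => intro m hm; exact absurd hm (Nat.not_lt_zero _)
    | succ k ih =>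
      intro m hm
      by_cases hmk : m < offset L k
      · exact ih m hmk
      · refine hG k _ ?_
        rw [hZ k]
        refine List.mem_map.2 ⟨m, List.mem_range'_1.2 ⟨by omega, ?_⟩, rfl⟩
        simpa only [offset] using hm
  have hZG : ∀ m, Z m ∈ G := fun m => hcover (m + 1) m (le_offset hne (m + 1))
  refine ⟨1, fun _ => Z, fun _ n => ?_, fun _ => ?_, ?_⟩
  · rcases hZG n with h1 | ⟨Y, -, hY⟩
    · exact (congrArg (· ∈ regular A) h1).mpr (regular A).one_mem
    · exact (congrArg (· ∈ regular A) hY).mp Y.2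
  · refine ((hF.image Subtype.val).insert (1 : Language A)).subset ?_
    rintro _ ⟨m, rfl⟩
    exact hZG m
  · rw [hprod, infProd_flat L hne Z hZ]
    exact (Set.iUnion_const (infProd Z)).symm

end Words

/-! ## The structure of `(R(A*), R'(A^∞))` -/

section Free

variable {A : Type u}

/-- `R'(A^∞)` is ordered by inclusion. -/
instance : PartialOrder (RegInf A) :=
  inferInstanceAs (PartialOrder {Y : Set (InfWord A) // IsRegInf Y})

instance : Add (RegInf A) where
  add Y Z := ⟨Y.1 ∪ Z.1, Y.2.union Z.2⟩

instance : Zero (RegInf A) where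
  zero := ⟨∅, isRegInf_empty⟩

/-- The sum on `R'(A^∞)` is union, with neutral element the empty set. -/
instance : AddCommMonoid (RegInf A) where
  add_assoc Y Z W := Subtype.ext (Set.union_assoc Y.1 Z.1 W.1)
  zero_add Y := Subtype.ext (Set.empty_union Y.1)
  add_zero Y := Subtype.ext (Set.union_empty Y.1)
  add_comm Y Z := Subtype.ext (Set.union_comm Y.1 Z.1)
  nsmul := nsmulRec

instance : SMul (RegLang A) (RegInf A) where
  smul X Y := ⟨act X.1 Y.1, Y.2.act X.2⟩

/-- The action of `R(A*)` on `R'(A^∞)` is concatenation. -/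
instance : Module (RegLang A) (RegInf A) where
  one_smul Y := by
    refine Subtype.ext (Set.ext fun w => ⟨?_, fun hw => ⟨[], rfl, w, hw, append_nil w⟩⟩)
    rintro ⟨x, hx, y, hy, rfl⟩
    have hx' : x = [] := hx
    rw [hx', append_nil]
    exact hy
  mul_smul X X' Y := by
    refine Subtype.ext (Set.ext fun w => ⟨?_, ?_⟩)
    · rintro ⟨_, ⟨x, hx, x', hx', rfl⟩, y, hy, rfl⟩
      exact ⟨x, hx, _, ⟨x', hx', y, hy, rfl⟩, (append_append x x' y).symm⟩
    · rintro ⟨x, hx, _, ⟨x', hx', y, hy, rfl⟩, rfl⟩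
      exact ⟨_, ⟨x, hx, x', hx', rfl⟩, y, hy, append_append x x' y⟩
  smul_zero X := by
    refine Subtype.ext (Set.eq_empty_of_forall_notMem ?_)
    rintro _ ⟨x, hx, y, hy, rfl⟩
    exact hy
  zero_smul Y := by
    refine Subtype.ext (Set.eq_empty_of_forall_notMem ?_)
    rintro _ ⟨x, hx, y, hy, rfl⟩
    exact hx
  smul_add X Y Z := by
    refine Subtype.ext (Set.ext fun w => ⟨?_, ?_⟩)
    · rintro ⟨x, hx, y, hy | hy, rfl⟩
      · exact .inl ⟨x, hx, y, hy, rfl⟩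
      · exact .inr ⟨x, hx, y, hy, rfl⟩
    · rintro (⟨x, hx, y, hy, rfl⟩ | ⟨x, hx, y, hy, rfl⟩)
      · exact ⟨x, hx, y, .inl hy, rfl⟩
      · exact ⟨x, hx, y, .inr hy, rfl⟩
  add_smul X X' Y := by
    refine Subtype.ext (Set.ext fun w => ⟨?_, ?_⟩)
    · rintro ⟨x, hx | hx, y, hy, rfl⟩
      · exact .inl ⟨x, hx, y, hy, rfl⟩
      · exact .inr ⟨x, hx, y, hy, rfl⟩
    · rintro (⟨x, hx, y, hy, rfl⟩ | ⟨x, hx, y, hy, rfl⟩)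
      · exact ⟨x, .inl hx, y, hy, rfl⟩
      · exact ⟨x, .inr hx, y, hy, rfl⟩

/-- The infinite product of a finitary sequence of regular languages is its infinite
concatenation. -/
instance : FinitaryProd (RegLang A) (RegInf A) where
  prod X hX := ⟨infProd fun n => (X n).1, isRegInf_infProd hX⟩

end Free

end KleeneOmega

/-! On the Kleene algebra side, `*`-continuity makes the value of a regular language the supremum of
the values of its words. This supremum is preserved by multiplication on both sides and by the
action (`IsLangSup`), so it depends on the language alone and gives a homomorphism.

On the semimodule side, the value of a finite union of infinite products has to be the sum of the
products of the values. What needs proof is that this does not depend on the presentation. The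
stronger claim `valuePairs_mono` says that the value is monotone in the set of words. The value is
not treated simply as a supremum of word values, because the action is not assumed to preserve
arbitrary suprema in `V`.

Monotonicity is proved by induction on how the factors are built (`Reducible`): start with finitely
many letters and adjoin one language `e` at a time, which is empty, a sum or a star over the
languages already present. By `exists_regroup_insert`, a product over `F ∪ {e}` becomes a prefix `p`
followed either by a product over `F` or by `∏ e yₙ` with all `yₙ` over `F`. In the second case the
axioms for sums and stars turn `∏ e yₙ` into a supremum of products over `F` (`Reduces`). The prefix
is a supremum of words `x`, and each `x` is moved to the other side of the inequality by a left
quotient (`exists_quotient_word`): the target `q` is replaced by some `r` that contains the quotient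
of `q` by `x`, while the value of `x` times that of `r` stays below that of `q`.

At the bottom, a product of one-word languages denotes a single word `w`, and the value of `w` must
lie below every finite sum of products containing it. This is `le_of_mem_valuePairs`, which rests on
the same induction in `Reducible.le_evalProd`. Uniqueness holds because letters generate the regular
languages and infinite products generate `R'(A^∞)` additively. -/

namespace KleeneOmega

universe u v w

/-! ### Regrouping the factors of an infinite product -/

section Regrouping

variable {M : Type v} [Monoid M]

/-- Positions `0 = i 0 ≤ i 1 ≤ ⋯` increasing without bound. -/
def IsCut (i : ℕ → ℕ) : Prop :=
  i 0 = 0 ∧ Monotone i ∧ ∀ N, ∃ k, N ≤ i k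

/-- Two sequences are regroupings of each other if they arise from one finitary sequence by
multiplying consecutive blocks. -/
def Regroup (x y : ℕ → M) : Prop :=
  ∃ z : ℕ → M, IsFinitary z ∧ ∃ i j, IsCut i ∧ IsCut j ∧
    x = (fun k => blockProd z (i k) (i (k + 1))) ∧ y = fun k => blockProd z (j k) (j (k + 1))

theorem IsCut.of_id : IsCut fun k => k := ⟨rfl, monotone_id, fun N => ⟨N, le_rfl⟩⟩

theorem IsCut.of_cons {i : ℕ → ℕ} (h : StrictMono i) : IsCut (consSeq 0 i) := by
  refine ⟨rfl, monotone_nat_of_le_succ ?_, fun N => ⟨N + 1, h.le_apply⟩⟩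
  rintro (_ | n)
  · exact Nat.zero_le _
  · exact h.monotone n.le_succ

theorem blockProd_succ (x : ℕ → M) (i : ℕ) : blockProd x i (i + 1) = x i := by
  simp [blockProd]

theorem blockProd_mul (x : ℕ → M) {i j k : ℕ} (h : i ≤ j) (h' : j ≤ k) :
    blockProd x i j * blockProd x j k = blockProd x i k := by
  rw [blockProd, blockProd, blockProd, ← List.prod_append, ← List.map_append]
  have := List.range'_append (s := i) (m := j - i) (n := k - j) (step := 1)
  rw [show i + 1 * (j - i) = j by omega, show j - i + (k - j) = k - i by omega] at this
  rw [← this]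

theorem map_blockProd {N : Type w} [Monoid N] (f : M →* N) (x : ℕ → M) (i j : ℕ) :
    f (blockProd x i j) = blockProd (fun n => f (x n)) i j := by
  rw [blockProd, map_list_prod, List.map_map]
  rfl

theorem blockProd_mem (s : Submonoid M) {x : ℕ → M} {i j : ℕ}
    (h : ∀ m, i ≤ m → m < j → x m ∈ s) : blockProd x i j ∈ s := by
  refine s.list_prod_mem fun y hy => ?_
  obtain ⟨m, hm, rfl⟩ := List.mem_map.1 hy
  rw [List.mem_range'_1] at hm
  exact h m hm.1 (by omega)

theorem IsFinitary.cons {x : M} {y : ℕ → M} (hy : IsFinitary y) : IsFinitary (consSeq x y) := by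
  rw [isFinitary_iff] at *
  obtain ⟨F, hF, h⟩ := hy
  refine ⟨insert x F, hF.insert x, ?_⟩
  rintro (_ | n)
  · exact Submonoid.subset_closure (.inl rfl)
  · exact Submonoid.closure_mono (Set.subset_insert x F) (h n)

/-- A sequence of finite products can be written out factor by factor. -/
theorem exists_flatten {F : Set M} {x : ℕ → M} (h : ∀ n, x n ∈ Submonoid.closure F) :
    ∃ z : ℕ → M, (∀ m, z m ∈ insert 1 F) ∧ ∃ i, IsCut i ∧
      x = fun k => blockProd z (i k) (i (k + 1)) := by
  choose l hl e using fun n => Submonoid.exists_list_of_mem_closure (h n)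
  -- The extra `1` makes every list nonempty; with empty lists the factors might not fill an
  -- infinite sequence.
  let L : ℕ → List M := fun k => 1 :: l k
  have hne : ∀ k, L k ≠ [] := fun k => List.cons_ne_nil _ _
  obtain ⟨z, hz⟩ := exists_flat L hne
  have hL : ∀ k, ∀ y ∈ L k, y ∈ insert 1 F := by
    intro k y hy
    rcases List.mem_cons.1 hy with rfl | hy
    · exact .inl rfl
    · exact .inr (hl k y hy)
  have hcover : ∀ k, ∀ m < offset L k, z m ∈ insert 1 F := by
    intro k
    induction k with
    | zero => intro m hm; exact absurd hm (Nat.not_lt_zero _)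
    | succ k ih =>
      intro m hm
      by_cases hmk : m < offset L k
      · exact ih m hmk
      · refine hL k _ ?_
        rw [hz k]
        refine List.mem_map.2 ⟨m, List.mem_range'_1.2 ⟨by omega, ?_⟩, rfl⟩
        simpa only [offset] using hm
  refine ⟨z, fun m => hcover (m + 1) m (le_offset hne (m + 1)), offset L,
    ⟨rfl, monotone_nat_of_le_succ fun k => Nat.le_add_right _ _, fun N => ⟨N, le_offset hne N⟩⟩,
    funext fun k => ?_⟩
  have h1 : x k = (L k).prod := by simp [L, e]
  rw [h1, hz k, blockProd]
  simp [offset]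

theorem isFinitary_of_mem_insert {F : Set M} (hF : F.Finite) {z : ℕ → M}
    (h : ∀ m, z m ∈ insert 1 F) : IsFinitary z :=
  .of_finite _ (hF.insert 1) h

/-- A sequence of finite products of elements of `F` and `e` can be regrouped into a first factor
followed by a sequence that either avoids `e`, or consists of products starting with `e` and not
involving `e` otherwise. -/
theorem exists_regroup_insert {F : Set M} (hF : F.Finite) (e : M) {x : ℕ → M}
    (h : ∀ n, x n ∈ Submonoid.closure (insert e F)) :
    ∃ (p : M) (y : ℕ → M), (∀ n, y n ∈ Submonoid.closure F) ∧
      (Regroup x (consSeq p y) ∨ Regroup x (consSeq p fun n => e * y n)) := by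
  classical
  obtain ⟨z, hz, i, hi, hx⟩ := exists_flatten h
  have hfin := isFinitary_of_mem_insert (hF.insert e) hz
  have hzF : ∀ m, z m ≠ e → z m ∈ Submonoid.closure F := by
    intro m hm
    rcases hz m with h1 | h1 | h1
    · exact h1 ▸ one_mem _
    · exact absurd h1 hm
    · exact Submonoid.subset_closure h1
  by_cases hinf : {m | z m = e}.Infinite
  -- `t` enumerates the positions of `e`. Cutting just before each of them makes every later block
  -- start with `e`.
  · let t := Nat.nth fun m => z m = e
    have ht : StrictMono t := Nat.nth_strictMono hinf
    have hte : ∀ k, z (t k) = e := fun k => Nat.nth_mem_of_infinite hinf k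
    refine ⟨blockProd z 0 (t 0), fun k => blockProd z (t k + 1) (t (k + 1)), fun k => ?_,
      .inr ⟨z, hfin, i, _, hi, IsCut.of_cons ht, hx, funext ?_⟩⟩
    · refine blockProd_mem _ fun m h1 h2 => hzF m fun h3 => ?_
      -- An occurrence of `e` strictly between `t k` and `t (k + 1)` would be some `t l` with `k < l
      -- < k + 1`.
      have h4 := Nat.nth_count (p := fun m => z m = e) h3
      have h5 : t k < t (Nat.count (fun m => z m = e) m) := by
        simp only [t] at h4 h1 ⊢
        omega
      have h6 : t (Nat.count (fun m => z m = e) m) < t (k + 1) := by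
        simp only [t] at h4 h2 ⊢
        omega
      have h7 := ht.lt_iff_lt.1 h5
      have h8 := ht.lt_iff_lt.1 h6
      omega
    · rintro (_ | k)
      · rfl
      · change e * _ = blockProd z (t k) (t (k + 1))
        rw [← blockProd_mul z (t k).le_succ (ht k.lt_succ_self), blockProd_succ, hte]
  · rw [Set.not_infinite] at hinf
    obtain ⟨N, hN⟩ := hinf.bddAbove
    refine ⟨blockProd z 0 (N + 1), fun k => z (N + 1 + k), fun k => hzF _ fun h1 => ?_,
      .inl ⟨z, hfin, i, consSeq 0 fun k => N + 1 + k, hi,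
        IsCut.of_cons fun a b hab => by simpa using hab, hx, funext ?_⟩⟩
    · have : N + 1 + k ≤ N := hN h1
      omega
    · rintro (_ | k)
      · rfl
      · exact (blockProd_succ z (N + 1 + k)).symm

/-- `a₀b₀ · a₁b₁ ⋯ = a₀ · b₀a₁ · b₁a₂ ⋯`. -/
theorem regroup_shift {a b : ℕ → M} (ha : IsFinitary a) (hb : IsFinitary b) :
    Regroup (fun n => a n * b n) (fun n => consSeq 1 b n * a n) := by
  -- The common refinement is `a₀, b₀, a₁, b₁, …`. The left side cuts it at even positions, the
  -- right side at `0` and the odd positions.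
  let z : ℕ → M := fun m => if m % 2 = 0 then a (m / 2) else b (m / 2)
  have hz : IsFinitary z := by
    rw [isFinitary_iff] at *
    obtain ⟨F, hF, ha⟩ := ha
    obtain ⟨G, hG, hb⟩ := hb
    refine ⟨F ∪ G, hF.union hG, fun n => ?_⟩
    simp only [z]
    split
    · exact Submonoid.closure_mono Set.subset_union_left (ha _)
    · exact Submonoid.closure_mono Set.subset_union_right (hb _)
  have h0 : ∀ n, z (2 * n) = a n := fun n => by simp [z]
  have h1 : ∀ n, z (2 * n + 1) = b n := fun n => by
    simp only [z, show (2 * n + 1) % 2 = 1 by omega, show (2 * n + 1) / 2 = n by omega]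
    simp
  have hpair : ∀ m, blockProd z m (m + 2) = z m * z (m + 1) := fun m => by
    rw [← blockProd_mul z m.le_succ (m + 1).le_succ, blockProd_succ, blockProd_succ]
  refine ⟨z, hz, fun k => 2 * k, consSeq 0 fun k => 2 * k + 1,
    ⟨rfl, ?_, fun N => ⟨N, by dsimp only; omega⟩⟩,
    IsCut.of_cons ?_, funext fun k => ?_, funext ?_⟩
  · intro a b hab; dsimp only; omega
  · intro a b hab; dsimp only; omega
  · rw [← h0, ← h1]
    exact (hpair (2 * k)).symm
  · rintro (_ | k)
    · change 1 * a 0 = blockProd z 0 1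
      rw [blockProd_succ, one_mul, ← h0]
    · change b k * a (k + 1) = blockProd z (2 * k + 1) (2 * k + 1 + 2)
      rw [hpair, ← h1, ← h0]
      rfl

end Regrouping

/-! ### Invariance of infinite products under regrouping -/

section Algebra

variable {S : Type v} {V : Type w} [KleeneAlgebra S] [FinitaryProd S V]

theorem prod_congr {x y : ℕ → S} (h : x = y) (hx : IsFinitary x) (hy : IsFinitary y) :
    (FinitaryProd.prod x hx : V) = FinitaryProd.prod y hy := by
  subst h; rfl

variable [AddCommMonoid V] [PartialOrder V] [Module S V] [FinStarContKleeneOmegaAlgebra S V]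

/-- Both sides equal the product of the common refinement, by `prod_block`. The homomorphism `f`
lets one regrouping of languages serve for the languages themselves and for their values. -/
theorem prod_regroup {M : Type u} [Monoid M] (f : M →* S) {x y : ℕ → M} (h : Regroup x y)
    (hx : IsFinitary fun n => f (x n)) (hy : IsFinitary fun n => f (y n)) :
    (FinitaryProd.prod _ hx : V) = FinitaryProd.prod _ hy := by
  obtain ⟨z, hz, i, j, hi, hj, rfl, rfl⟩ := h
  have key : ∀ (i : ℕ → ℕ), IsCut i →
      ∀ hx : IsFinitary fun n => f (blockProd z (i n) (i (n + 1))),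
      (FinitaryProd.prod _ (hz.map f) : V) = FinitaryProd.prod _ hx := fun i hi hx =>
    (FinStarContKleeneOmegaAlgebra.prod_block _ (hz.map f) i hi.1 hi.2.1 hi.2.2).trans
      (prod_congr (funext fun k => (map_blockProd f z _ _).symm) _ _)
  exact (key i hi hx).symm.trans (key j hj hy)

end Algebra

/-! ### The natural order of the semimodule -/

section Semimodule

open FinStarContKleeneOmegaAlgebra

/-- Addition on `V` is idempotent because `v ≤ v`. `S` is explicit since only the algebra structure
over `S` links order and addition, and the conclusion does not mention it. -/
theorem le_add_left_of_algebra (S : Type v) {V : Type w} [KleeneAlgebra S] [AddCommMonoid V]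
    [PartialOrder V] [Module S V] [FinitaryProd S V] [FinStarContKleeneOmegaAlgebra S V]
    (v v' : V) : v ≤ v' + v := by
  have h := (le_iff_add_eq (S := S) v v).1 le_rfl
  rw [le_iff_add_eq (S := S), add_left_comm, h]

theorem le_add_right_of_algebra (S : Type v) {V : Type w} [KleeneAlgebra S] [AddCommMonoid V]
    [PartialOrder V] [Module S V] [FinitaryProd S V] [FinStarContKleeneOmegaAlgebra S V]
    (v v' : V) : v ≤ v + v' :=
  add_comm v' v ▸ le_add_left_of_algebra S v v'

theorem add_le_of_algebra (S : Type v) {V : Type w} [KleeneAlgebra S] [AddCommMonoid V]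
    [PartialOrder V] [Module S V] [FinitaryProd S V] [FinStarContKleeneOmegaAlgebra S V]
    {v v' t : V} (h : v ≤ t) (h' : v' ≤ t) : v + v' ≤ t := by
  rw [le_iff_add_eq (S := S)] at *
  rw [add_assoc, h', h]

theorem zero_le_of_algebra (S : Type v) {V : Type w} [KleeneAlgebra S] [AddCommMonoid V]
    [PartialOrder V] [Module S V] [FinitaryProd S V] [FinStarContKleeneOmegaAlgebra S V]
    (v : V) : 0 ≤ v := by
  rw [le_iff_add_eq (S := S), zero_add]

variable {S : Type v} {V : Type w} [KleeneAlgebra S] [AddCommMonoid V]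
  [PartialOrder V] [Module S V] [FinitaryProd S V] [FinStarContKleeneOmegaAlgebra S V]

theorem smul_le_smul_of_algebra {s s' : S} {v v' : V} (h : s ≤ s') (h' : v ≤ v') :
    s • v ≤ s' • v' := by
  have h1 : s • v ≤ s' • v := by
    rw [le_iff_add_eq (S := S), ← add_smul, add_eq_right_iff_le.2 h]
  refine h1.trans ?_
  rw [le_iff_add_eq (S := S)] at h' ⊢
  rw [← smul_add, h']

end Semimodule

/-! ### The algebra of regular languages satisfies the axioms -/

section Words

variable {A : Type u}

/-- Cuts may repeat positions, so `n ≤ f n` can fail and `isLimit_subseq` does not apply.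
Monotonicity and unboundedness suffice for sequences of prefixes. -/
theorem isLimit_comp_of_unbounded (u : ℕ → List A) {f : ℕ → ℕ} (hf : ∀ N, ∃ k, N ≤ f k)
    (hm : Monotone f) (w : InfWord A) :
    IsLimit (fun n => partialConcat u (f n)) w ↔ IsLimit (partialConcat u) w := by
  choose g hg using hf
  cases w with
  | inl l =>
    constructor
    · rintro ⟨N, h⟩
      refine ⟨f N, fun n hn => ?_⟩
      have h1 := partialConcat_prefix u hn
      have h2 := partialConcat_prefix u ((hg n).trans (hm (le_max_right N (g n))))
      have h3 : partialConcat u (f N) = l := h N le_rfl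
      have h4 : partialConcat u (f (max N (g n))) = l := h _ (le_max_left _ _)
      rw [h3] at h1
      rw [h4] at h2
      exact h2.eq_of_length (le_antisymm h2.length_le h1.length_le)
    · rintro ⟨N, h⟩
      exact ⟨g N, fun n hn => h _ ((hg N).trans (hm hn))⟩
  | inr s =>
    constructor
    · rintro ⟨h, h'⟩
      refine ⟨fun n => ?_, fun m => ?_⟩
      · obtain ⟨t, ht⟩ := h (g n)
        obtain ⟨r, hr⟩ := partialConcat_prefix u (hg n)
        exact ⟨r ++ₛ t, by rw [← ht, ← Stream'.append_append_stream, hr]⟩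
      · obtain ⟨n, hn⟩ := h' m
        exact ⟨f n, hn⟩
    · rintro ⟨h, h'⟩
      refine ⟨fun n => h _, fun m => ?_⟩
      obtain ⟨n, hn⟩ := h' m
      exact ⟨g n, hn.trans (partialConcat_prefix u (hg n)).length_le⟩

/-- The word `u i u (i + 1) ⋯ u (j - 1)`. -/
def blockConcat (u : ℕ → List A) (i j : ℕ) : List A := ((List.range' i (j - i)).map u).flatten

theorem partialConcat_blockConcat (u : ℕ → List A) {i : ℕ → ℕ} (h0 : i 0 = 0) (hm : Monotone i)
    (n : ℕ) :
    partialConcat (fun k => blockConcat u (i k) (i (k + 1))) n = partialConcat u (i n) := by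
  induction n with
  | zero => rw [h0]; rfl
  | succ n ih =>
    rw [partialConcat_succ, ih, partialConcat, partialConcat, blockConcat,
      ← List.flatten_append, ← List.map_append, List.range_eq_range', List.range_eq_range']
    have h := hm n.le_succ
    simp only [Nat.succ_eq_add_one] at h
    have := List.range'_append (s := 0) (m := i n) (n := i (n + 1) - i n) (step := 1)
    rw [show 0 + 1 * i n = i n by omega, show i n + (i (n + 1) - i n) = i (n + 1) by omega] at this
    rw [this]

theorem isLimit_blockConcat (u : ℕ → List A) {i : ℕ → ℕ} (hi : IsCut i) (w : InfWord A) :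
    IsLimit (partialConcat fun k => blockConcat u (i k) (i (k + 1))) w ↔
      IsLimit (partialConcat u) w := by
  rw [← isLimit_comp_of_unbounded u hi.2.2 hi.2.1]
  simp only [← partialConcat_blockConcat u hi.1 hi.2.1]

theorem mem_blockProd {X : ℕ → Language A} {i j : ℕ} {v : List A} :
    v ∈ blockProd X i j ↔
      ∃ u : ℕ → List A, (∀ m, i ≤ m → m < j → u m ∈ X m) ∧ blockConcat u i j = v := by
  rw [blockProd, mem_list_prod]
  constructor
  · rintro ⟨c, hc, rfl⟩
    have hlen : c.length = j - i := by simpa using hc.length_eq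
    have hcu : c = (List.range' i (j - i)).map fun m => c.getD (m - i) [] := by
      apply List.ext_getElem
      · simp [hlen]
      · intro k h1 h2
        simp [h1]
    refine ⟨fun m => c.getD (m - i) [], fun m h1 h2 => ?_, ?_⟩
    · rw [hcu] at hc
      exact (forall₂_map_iff _ X _).1 hc m (List.mem_range'_1.2 ⟨h1, by omega⟩)
    · rw [blockConcat, ← hcu]
  · rintro ⟨u, hu, rfl⟩
    refine ⟨_, (forall₂_map_iff u X _).2 fun m hm => ?_, rfl⟩
    rw [List.mem_range'_1] at hm
    exact hu m hm.1 (by omega)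

theorem IsCut.exists_mem {i : ℕ → ℕ} (hi : IsCut i) (m : ℕ) : ∃ k, i k ≤ m ∧ m < i (k + 1) := by
  classical
  have h := hi.2.2 (m + 1)
  have h1 := Nat.find_spec h
  have h2 : Nat.find h ≠ 0 := by
    intro h3
    rw [h3, hi.1] at h1
    omega
  obtain ⟨k, hk⟩ := Nat.exists_eq_succ_of_ne_zero h2
  have h4 := Nat.find_min h (m := k) (by omega)
  rw [hk] at h1
  exact ⟨k, by omega, h1⟩

theorem IsCut.eq_of_mem {i : ℕ → ℕ} (hi : IsCut i) {m k l : ℕ} (h1 : i k ≤ m)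
    (h2 : m < i (k + 1)) (h3 : i l ≤ m) (h4 : m < i (l + 1)) : k = l := by
  by_contra hne
  rcases Nat.lt_or_gt_of_ne hne with h | h
  · have := hi.2.1 (Nat.succ_le_of_lt h)
    simp only [Nat.succ_eq_add_one] at this
    omega
  · have := hi.2.1 (Nat.succ_le_of_lt h)
    simp only [Nat.succ_eq_add_one] at this
    omega

theorem infProd_blockProd (X : ℕ → Language A) {i : ℕ → ℕ} (hi : IsCut i) :
    infProd (fun k => blockProd X (i k) (i (k + 1))) = infProd X := by
  ext w
  constructor
  · rintro ⟨v, hv, hw⟩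
    choose g hg hgv using fun k => mem_blockProd.1 (hv k)
    choose b hb1 hb2 using hi.exists_mem
    -- Each block has its own factorization `g k`. They are glued by using at position `m` the one
    -- of the unique block `b m` containing `m`.
    have hvu : v = fun k => blockConcat (fun m => g (b m) m) (i k) (i (k + 1)) := by
      funext k
      rw [← hgv k, blockConcat, blockConcat]
      congr 1
      refine List.map_congr_left fun m hm => ?_
      rw [List.mem_range'_1] at hm
      rw [hi.eq_of_mem (hb1 m) (hb2 m) hm.1 (by omega)]
    refine ⟨fun m => g (b m) m, fun m => hg _ m (hb1 m) (hb2 m), ?_⟩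
    rw [hvu] at hw
    exact (isLimit_blockConcat _ hi w).1 hw
  · rintro ⟨u, hu, hw⟩
    exact ⟨_, fun k => mem_blockProd.2 ⟨u, fun m _ _ => hu m, rfl⟩,
      (isLimit_blockConcat u hi w).2 hw⟩

theorem infProd_mono {X Y : ℕ → Language A} (h : ∀ n, X n ≤ Y n) : infProd X ⊆ infProd Y :=
  fun _ ⟨u, hu, hw⟩ => ⟨u, fun n => h n (hu n), hw⟩

theorem act_mono {X X' : Language A} {Y Y' : Set (InfWord A)} (h : X ≤ X') (h' : Y ⊆ Y') :
    act X Y ⊆ act X' Y' :=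
  fun _ ⟨x, hx, y, hy, e⟩ => ⟨x, h hx, y, h' hy, e⟩

/-- A single word uses one summand at each position, so distributivity over infinitely many factors
is a choice made position by position. -/
theorem mem_infProd_add {Y Z : ℕ → Language A} {w : InfWord A}
    (hw : w ∈ infProd fun n => Y n + Z n) :
    ∃ c : ℕ → Bool, w ∈ infProd fun n => cond (c n) (Y n) (Z n) := by
  obtain ⟨u, hu, hw⟩ := hw
  have h : ∀ n, ∃ c : Bool, u n ∈ cond c (Y n) (Z n) := fun n =>
    (hu n).elim (fun h => ⟨true, h⟩) fun h => ⟨false, h⟩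
  choose c hc using h
  exact ⟨c, u, hc, hw⟩

theorem mem_infProd_kstar_mul {X : Language A} {Y : ℕ → Language A} {w : InfWord A}
    (hw : w ∈ infProd fun n => X∗ * Y n) :
    ∃ k : ℕ → ℕ, w ∈ infProd fun n => X ^ k n * Y n := by
  obtain ⟨u, hu, hw⟩ := hw
  have h : ∀ n, ∃ k : ℕ, u n ∈ X ^ k * Y n := fun n => by
    obtain ⟨a, ha, b, hb, e⟩ := hu n
    change a ∈ X∗ at ha
    rw [Language.kstar_eq_iSup_pow, Language.mem_iSup] at ha
    obtain ⟨k, hk⟩ := ha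
    exact ⟨k, a, hk, b, hb, e⟩
  choose k hk using h
  exact ⟨k, u, hk, hw⟩

theorem act_kstar (X Y : Language A) (Z : Set (InfWord A)) :
    act (X * Y∗) Z = ⋃ n : ℕ, act (X * Y ^ n) Z := by
  ext w
  simp only [Set.mem_iUnion]
  constructor
  · rintro ⟨_, ⟨x, hx, y, hy, rfl⟩, z, hz, e⟩
    change y ∈ Y∗ at hy
    rw [Language.kstar_eq_iSup_pow, Language.mem_iSup] at hy
    obtain ⟨n, hn⟩ := hy
    exact ⟨n, _, ⟨x, hx, y, hn, rfl⟩, z, hz, e⟩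
  · rintro ⟨n, hn⟩
    exact act_mono (mul_le_mul_right pow_le_kstar _) subset_rfl hn

theorem blockProd_val (X : ℕ → RegLang A) (i j : ℕ) :
    (blockProd X i j).1 = blockProd (fun n => (X n).1) i j :=
  map_blockProd ((regular A).subtype : RegLang A →* Language A) X i j

/-- `(R(A*), R'(A^∞))` is a finitary `*`-continuous Kleene `ω`-algebra. -/
instance instAlgebraRegLang : FinStarContKleeneOmegaAlgebra (RegLang A) (RegInf A) where
  star_continuous X Y Z := by
    refine ⟨?_, fun U hU => ?_⟩
    · rintro _ ⟨n, rfl⟩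
      exact mul_le_mul_left (mul_le_mul_right pow_le_kstar X) Z
    · rintro _ ⟨_, ⟨x, hx, y, hy, rfl⟩, z, hz, rfl⟩
      change y ∈ Y.1∗ at hy
      rw [Language.kstar_eq_iSup_pow, Language.mem_iSup] at hy
      obtain ⟨n, hn⟩ := hy
      exact hU ⟨n, rfl⟩ ⟨_, ⟨x, hx, y, hn, rfl⟩, z, hz, rfl⟩
  le_iff_add_eq Y Z := (Set.union_eq_right (s := Y.1) (t := Z.1)).symm.trans
    (Subtype.ext_iff (a1 := Y + Z) (a2 := Z)).symm
  star_smul X Y Z := by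
    have h := act_kstar X.1 Y.1 Z.1
    refine ⟨?_, fun U hU => ?_⟩
    · rintro _ ⟨n, rfl⟩
      exact h.ge.trans' (Set.subset_iUnion (fun n : ℕ => act (X.1 * Y.1 ^ n) Z.1) n)
    · exact h.le.trans (Set.iUnion_subset fun n => hU ⟨n, rfl⟩)
  prod_cons X hX := Subtype.ext <| by
    refine Eq.trans ?_ (act_infProd (X 0).1 fun n => (X (n + 1)).1).symm
    change infProd _ = _
    congr 1
    funext n
    cases n <;> rfl
  prod_block X hX i h0 hm hu := Subtype.ext <| by
    change infProd _ = infProd fun k => (blockProd X (i k) (i (k + 1))).1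
    simp only [blockProd_val]
    exact (infProd_blockProd _ ⟨h0, hm, hu⟩).symm
  prod_add X hX Y Z := by
    refine ⟨?_, fun U hU w hw => ?_⟩
    · rintro _ ⟨c, rfl⟩
      refine infProd_mono (Y := fun n => (X n).1 * (Y.1 + Z.1)) fun n => ?_
      change (X n * c.1 n) ≤ X n * (Y + Z)
      refine mul_le_mul_right ?_ _
      rcases c.2 n with h | h <;> rw [h]
      · exact le_sup_left (a := Y) (b := Z)
      · exact le_sup_right (a := Y) (b := Z)
    · obtain ⟨c, hc⟩ := mem_infProd_add (Y := fun n => (X n * Y).1) (Z := fun n => (X n * Z).1)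
        (infProd_mono (fun n => (mul_add (X n).1 Y.1 Z.1).le) hw)
      refine hU ⟨⟨fun n => cond (c n) Y Z, fun n => ?_⟩, rfl⟩ ?_
      · cases h : c n <;> simp [h]
      · refine infProd_mono (fun n => ?_) hc
        change _ ≤ (X n * cond (c n) Y Z).1
        cases c n <;> rfl
  prod_star X Y hY := by
    refine ⟨?_, fun U hU w hw => ?_⟩
    · rintro _ ⟨k, rfl⟩
      exact infProd_mono fun n => mul_le_mul_left (pow_le_kstar (a := X) (n := k n)) (Y n)
    · obtain ⟨k, hk⟩ := mem_infProd_kstar_mul (X := X.1) (Y := fun n => (Y n).1) hw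
      exact hU ⟨k, rfl⟩ hk

end Words

/-! ### Values of regular languages as suprema over their words -/

section Evaluation

variable {A : Type u} {S : Type v} [KleeneAlgebra S]

/-- The value of a finite word under a valuation of its letters. -/
def evalWord (h : A → S) (x : List A) : S := (x.map h).prod

theorem evalWord_nil (h : A → S) : evalWord h [] = 1 := rfl

theorem evalWord_cons (h : A → S) (a : A) (x : List A) :
    evalWord h (a :: x) = h a * evalWord h x := by
  simp [evalWord]

theorem evalWord_append (h : A → S) (x y : List A) :
    evalWord h (x ++ y) = evalWord h x * evalWord h y := by
  simp [evalWord]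

/-- `s` is the supremum of the values of the words in `L`, and this supremum is preserved by
multiplication and by the action on `V`. -/
structure IsLangSup (V : Type w) [AddCommMonoid V] [PartialOrder V] [Module S V] (h : A → S)
    (L : Language A) (s : S) : Prop where
  mul_mul_le_iff : ∀ x z t : S, x * s * z ≤ t ↔ ∀ u ∈ L, x * evalWord h u * z ≤ t
  mul_smul_le_iff : ∀ (x : S) (v t : V), (x * s) • v ≤ t ↔ ∀ u ∈ L, (x * evalWord h u) • v ≤ t

variable {V : Type w} [AddCommMonoid V] [PartialOrder V] [Module S V]

namespace IsLangSup

variable {h : A → S} {L L' : Language A} {s s' : S}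

theorem le_iff (hs : IsLangSup V h L s) (t : S) : s ≤ t ↔ ∀ u ∈ L, evalWord h u ≤ t := by
  simpa using hs.mul_mul_le_iff 1 1 t

theorem smul_le_iff (hs : IsLangSup V h L s) (v t : V) :
    s • v ≤ t ↔ ∀ u ∈ L, evalWord h u • v ≤ t := by
  simpa using hs.mul_smul_le_iff 1 v t

theorem unique (hs : IsLangSup V h L s) (hs' : IsLangSup V h L s') : s = s' :=
  le_antisymm ((hs.le_iff _).2 ((hs'.le_iff _).1 le_rfl))
    ((hs'.le_iff _).2 ((hs.le_iff _).1 le_rfl))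

theorem one : IsLangSup V h 1 1 :=
  ⟨fun x z t => by simp [Language.mem_one, evalWord_nil],
    fun x v t => by simp [Language.mem_one, evalWord_nil]⟩

/-- The quantification over contexts in `IsLangSup` is what makes this work: `s'` is absorbed into
the context of `s`, and then each word of `L` into the context of `s'`. -/
theorem mul (hs : IsLangSup V h L s) (hs' : IsLangSup V h L' s') :
    IsLangSup V h (L * L') (s * s') := by
  constructor
  · intro x z t
    rw [← mul_assoc, mul_assoc _ s' z, hs.mul_mul_le_iff]
    simp only [← mul_assoc, hs'.mul_mul_le_iff]
    constructor
    · rintro H _ ⟨a, ha, b, hb, rfl⟩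
      dsimp only
      rw [evalWord_append, ← mul_assoc]
      exact H a ha b hb
    · intro H a ha b hb
      have := H _ ⟨a, ha, b, hb, rfl⟩
      dsimp only at this
      rwa [evalWord_append, ← mul_assoc] at this
  · intro x v t
    rw [← mul_assoc, mul_smul, hs.mul_smul_le_iff]
    simp only [← mul_smul, hs'.mul_smul_le_iff]
    constructor
    · rintro H _ ⟨a, ha, b, hb, rfl⟩
      dsimp only
      rw [evalWord_append, ← mul_assoc]
      exact H a ha b hb
    · intro H a ha b hb
      have := H _ ⟨a, ha, b, hb, rfl⟩
      dsimp only at this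
      rwa [evalWord_append, ← mul_assoc] at this

theorem pow (hs : IsLangSup V h L s) (n : ℕ) : IsLangSup V h (L ^ n) (s ^ n) := by
  induction n with
  | zero => simpa using one
  | succ n ih => rw [pow_succ, pow_succ]; exact ih.mul hs

theorem singleton (x : List A) : IsLangSup V h ({x} : Language A) (evalWord h x) := by
  constructor
  · intro y z t
    exact ⟨fun H u hu => by rw [Set.mem_singleton_iff.1 hu]; exact H, fun H => H x rfl⟩
  · intro y z t
    exact ⟨fun H u hu => by rw [Set.mem_singleton_iff.1 hu]; exact H, fun H => H x rfl⟩

variable [FinitaryProd S V] [FinStarContKleeneOmegaAlgebra S V]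

theorem zero : IsLangSup V h 0 0 := by
  constructor
  · intro x z t
    rw [mul_zero, zero_mul]
    exact ⟨fun _ u hu => absurd hu (Language.notMem_zero u),
      fun _ => add_eq_right_iff_le.1 (zero_add t)⟩
  · intro x v t
    rw [mul_zero, zero_smul]
    exact ⟨fun _ u hu => absurd hu (Language.notMem_zero u), fun _ => zero_le_of_algebra S t⟩

theorem add (hs : IsLangSup V h L s) (hs' : IsLangSup V h L' s') :
    IsLangSup V h (L + L') (s + s') := by
  constructor
  · intro x z t
    rw [mul_add, add_mul, add_le_iff, hs.mul_mul_le_iff, hs'.mul_mul_le_iff]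
    simp only [Language.mem_add, or_imp, forall_and]
  · intro x v t
    have : (x * (s + s')) • v ≤ t ↔ (x * s) • v ≤ t ∧ (x * s') • v ≤ t := by
      rw [mul_add, add_smul]
      exact ⟨fun H => ⟨(le_add_right_of_algebra S _ _).trans H,
        (le_add_left_of_algebra S _ _).trans H⟩, fun H => add_le_of_algebra S H.1 H.2⟩
    rw [this, hs.mul_smul_le_iff, hs'.mul_smul_le_iff]
    simp only [Language.mem_add, or_imp, forall_and]

theorem kstar (hs : IsLangSup V h L s) : IsLangSup V h L∗ s∗ := by
  constructor
  · intro x z t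
    rw [isLUB_le_iff (FinStarContKleeneOmegaAlgebra.star_continuous V x s z),
      Language.kstar_eq_iSup_pow]
    simp only [mem_upperBounds, Set.forall_mem_range, (hs.pow _).mul_mul_le_iff, Language.mem_iSup]
    exact ⟨fun H u ⟨n, hn⟩ => H n u hn, fun H n u hn => H u ⟨n, hn⟩⟩
  · intro x v t
    rw [isLUB_le_iff (FinStarContKleeneOmegaAlgebra.star_smul x s v),
      Language.kstar_eq_iSup_pow]
    simp only [mem_upperBounds, Set.forall_mem_range, (hs.pow _).mul_smul_le_iff,
      Language.mem_iSup]
    exact ⟨fun H u ⟨n, hn⟩ => H n u hn, fun H n u hn => H u ⟨n, hn⟩⟩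

variable (V) in
-- Induction on an expression for `L`. The expression can be forgotten afterwards, since
-- `IsLangSup.unique` ties the value to the language.
theorem exists_of_mem_regular (h : A → S) (hL : L ∈ regular A) : ∃ s, IsLangSup V h L s := by
  obtain ⟨P, rfl⟩ := hL
  induction P with
  | zero => exact ⟨_, zero⟩
  | epsilon => exact ⟨_, one⟩
  | char a => exact ⟨_, singleton [a]⟩
  | plus P Q hP hQ =>
    obtain ⟨s, hs⟩ := hP
    obtain ⟨s', hs'⟩ := hQ
    exact ⟨_, hs.add hs'⟩
  | comp P Q hP hQ =>
    obtain ⟨s, hs⟩ := hP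
    obtain ⟨s', hs'⟩ := hQ
    exact ⟨_, hs.mul hs'⟩
  | star P hP =>
    obtain ⟨s, hs⟩ := hP
    exact ⟨_, hs.kstar⟩

end IsLangSup

variable [FinitaryProd S V] [FinStarContKleeneOmegaAlgebra S V]

variable (V) in
/-- The value of a regular language: the supremum of the values of its words. -/
noncomputable def evalLang (h : A → S) (X : RegLang A) : S :=
  Classical.choose (IsLangSup.exists_of_mem_regular V h X.2)

theorem isLangSup_evalLang (h : A → S) (X : RegLang A) : IsLangSup V h X.1 (evalLang V h X) :=
  Classical.choose_spec (IsLangSup.exists_of_mem_regular V h X.2)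

variable (V) in
/-- The extension of a valuation of the letters to the regular languages. -/
noncomputable def evalHom (h : A → S) : RegLang A →+* S where
  toFun := evalLang V h
  map_one' := (isLangSup_evalLang h 1).unique (V := V) .one
  map_mul' X Y := (isLangSup_evalLang h (X * Y)).unique
    ((isLangSup_evalLang (V := V) h X).mul (isLangSup_evalLang h Y))
  map_zero' := (isLangSup_evalLang h 0).unique (V := V) .zero
  map_add' X Y := (isLangSup_evalLang h (X + Y)).unique
    ((isLangSup_evalLang (V := V) h X).add (isLangSup_evalLang h Y))

theorem isLangSup_evalHom (h : A → S) (X : RegLang A) : IsLangSup V h X.1 (evalHom V h X) :=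
  isLangSup_evalLang h X

theorem evalHom_kstar (h : A → S) (X : RegLang A) : evalHom V h X∗ = (evalHom V h X)∗ :=
  (isLangSup_evalHom h X∗).unique ((isLangSup_evalHom (V := V) h X).kstar)

theorem evalHom_letter (h : A → S) (a : A) : evalHom V h (RegLang.letter a) = h a := by
  refine (isLangSup_evalHom h (RegLang.letter a)).unique (V := V) ?_
  have := IsLangSup.singleton (V := V) (h := h) [a]
  rwa [evalWord_cons, evalWord_nil, mul_one] at this

theorem evalWord_le_evalHom (h : A → S) {X : RegLang A} {x : List A} (hx : x ∈ X.1) :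
    evalWord h x ≤ evalHom V h X :=
  ((isLangSup_evalHom (V := V) h X).le_iff _).1 le_rfl x hx

theorem evalHom_mono (h : A → S) {X Y : RegLang A} (hXY : X ≤ Y) :
    evalHom V h X ≤ evalHom V h Y :=
  ((isLangSup_evalHom (V := V) h X).le_iff _).2 fun _ hx => evalWord_le_evalHom h (hXY hx)

/-- A homomorphism of Kleene algebras on the regular languages is determined by its values at
the letters. -/
theorem ringHom_ext_of_letter {T : Type v} [KleeneAlgebra T] {f g : RegLang A →+* T}
    (hf : ∀ X, f X∗ = (f X)∗) (hg : ∀ X, g X∗ = (g X)∗)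
    (h : ∀ a, f (RegLang.letter a) = g (RegLang.letter a)) : f = g := by
  refine RingHom.ext fun X => ?_
  obtain ⟨_, P, rfl⟩ := X
  induction P with
  | zero => exact f.map_zero.trans g.map_zero.symm
  | epsilon => exact f.map_one.trans g.map_one.symm
  | char a => exact h a
  | plus P Q hP hQ =>
    exact (f.map_add ⟨_, P, rfl⟩ ⟨_, Q, rfl⟩).trans
      ((congrArg₂ _ hP hQ).trans (g.map_add ⟨_, P, rfl⟩ ⟨_, Q, rfl⟩).symm)
  | comp P Q hP hQ =>
    exact (f.map_mul ⟨_, P, rfl⟩ ⟨_, Q, rfl⟩).trans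
      ((congrArg₂ _ hP hQ).trans (g.map_mul ⟨_, P, rfl⟩ ⟨_, Q, rfl⟩).symm)
  | star P hP =>
    exact (hf ⟨_, P, rfl⟩).trans ((congrArg _ hP).trans (hg ⟨_, P, rfl⟩).symm)

end Evaluation

/-! ### Values of single finite and infinite words -/

section WordValues

variable {A : Type u}

theorem getElem_of_append_stream {x : List A} {s t : Stream' A} (h : x ++ₛ t = s) {j : ℕ}
    (hj : j < x.length) : x[j] = s.get j := by
  rw [← h, Stream'.get_append_left _ _ _ hj]

theorem append_stream_drop {x : List A} {s : Stream' A}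
    (h : ∀ j (hj : j < x.length), x[j] = s.get j) : x ++ₛ s.drop x.length = s := by
  conv_rhs => rw [← Stream'.append_take_drop x.length s]
  congr 1
  apply List.ext_getElem
  · simp
  · intro j h1 h2
    refine (h j h1).trans (Option.some_injective _ ?_)
    rw [← Stream'.getElem?_take h1, List.getElem?_eq_getElem h2]

theorem exists_isLimit (u : ℕ → List A) : ∃ w, IsLimit (partialConcat u) w := by
  by_cases hb : BddAbove (Set.range fun n => (partialConcat u n).length)
  · obtain ⟨N, hN⟩ := Nat.sSup_mem (Set.range_nonempty _) hb
    refine ⟨.inl (partialConcat u N), N, fun n hn => ?_⟩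
    have h1 := partialConcat_prefix u hn
    refine (h1.eq_of_length (le_antisymm h1.length_le ?_)).symm
    exact (le_csSup hb ⟨n, rfl⟩).trans hN.ge
  · have hu : ∀ m, ∃ n, m < (partialConcat u n).length := by
      intro m
      by_contra! h
      exact hb ⟨m, by rintro _ ⟨n, rfl⟩; exact h n⟩
    choose g hg using hu
    -- The letter at `m` is read off any prefix longer than `m`; the choice is irrelevant because
    -- the partial concatenations are prefixes of one another.
    let s : Stream' A := fun m => (partialConcat u (g m))[m]'(hg m)
    refine ⟨.inr s, fun n => ⟨_, append_stream_drop fun j hj => ?_⟩,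
      fun m => ⟨g m, (hg m).le⟩⟩
    change _ = (partialConcat u (g j))[j]'(hg j)
    rcases le_total n (g j) with h | h
    · exact (partialConcat_prefix u h).getElem hj
    · exact ((partialConcat_prefix u h).getElem (hg j)).symm

variable {S : Type v} [KleeneAlgebra S] {V : Type w} [AddCommMonoid V] [Module S V]
  [FinitaryProd S V]

/-- `v` is the value of the word `w` under a valuation of the letters. An `ω`-word has a value only
if the values of its letters form a finitary sequence. -/
def IsWordValue (h : A → S) : InfWord A → V → Prop
  | .inl l, v => v = evalWord h l • FinitaryProd.prod (fun _ => (1 : S)) (.const 1)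
  | .inr s, v => ∃ hs : IsFinitary fun n => h (s.get n), v = FinitaryProd.prod _ hs

theorem IsWordValue.unique {h : A → S} {w : InfWord A} {v v' : V} (hv : IsWordValue h w v)
    (hv' : IsWordValue h w v') : v = v' := by
  cases w with
  | inl l => exact hv.trans hv'.symm
  | inr s =>
    obtain ⟨_, rfl⟩ := hv
    obtain ⟨_, rfl⟩ := hv'
    rfl

theorem blockProd_evalWord (h : A → S) (u : ℕ → List A) (n : ℕ) :
    blockProd (fun k => evalWord h (u k)) 0 n = evalWord h (partialConcat u n) := by
  induction n with
  | zero => rfl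
  | succ n ih =>
    rw [← blockProd_mul _ n.zero_le n.le_succ, ih, blockProd_succ, partialConcat_succ,
      evalWord_append]

theorem isFinitary_evalWord (h : A → S) {B : Set A} (hB : B.Finite) {u : ℕ → List A}
    (hu : ∀ n, ∀ a ∈ u n, a ∈ B) : IsFinitary fun n => evalWord h (u n) :=
  ⟨h '' B, hB.image h, fun n => ⟨(u n).map h, by
    simp only [List.mem_map, forall_exists_index, and_imp, forall_apply_eq_imp_iff₂]
    exact fun a ha => ⟨a, hu n a ha, rfl⟩, rfl⟩⟩

theorem mem_of_mem_partialConcat {B : Set A} {u : ℕ → List A} (hu : ∀ n, ∀ a ∈ u n, a ∈ B)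
    {n : ℕ} {a : A} (ha : a ∈ partialConcat u n) : a ∈ B := by
  simp only [partialConcat, List.mem_flatten, List.mem_map] at ha
  obtain ⟨_, ⟨m, -, rfl⟩, ha⟩ := ha
  exact hu m a ha

variable [PartialOrder V] [FinStarContKleeneOmegaAlgebra S V]

theorem exists_isWordValue_of_append {h : A → S} (x : List A) {w : InfWord A} {v : V}
    (hv : IsWordValue h (append x w) v) :
    ∃ v', IsWordValue h w v' ∧ v = evalWord h x • v' := by
  cases w with
  | inl l =>
    refine ⟨_, rfl, hv.trans ?_⟩
    rw [evalWord_append, mul_smul]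
  | inr s =>
    induction x generalizing v with
    | nil => exact ⟨v, hv, by rw [evalWord_nil, one_smul]⟩
    | cons a x ih =>
      obtain ⟨hs, rfl⟩ := hv
      obtain ⟨v', hv', e⟩ := ih ⟨hs.tail, rfl⟩
      refine ⟨v', hv', ?_⟩
      rw [evalWord_cons, mul_smul, ← e]
      exact FinStarContKleeneOmegaAlgebra.prod_cons _ hs

theorem isWordValue_prod (h : A → S) {B : Set A} (hB : B.Finite) {u : ℕ → List A}
    (hu : ∀ n, ∀ a ∈ u n, a ∈ B) {w : InfWord A} (hw : IsLimit (partialConcat u) w)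
    (hf : IsFinitary fun n => evalWord h (u n)) :
    IsWordValue h w (FinitaryProd.prod _ hf : V) := by
  cases w with
  | inl l =>
    obtain ⟨N, hN⟩ := hw
    have hnil : ∀ n, N ≤ n → u n = [] := fun n hn => by
      have h1 := hN (n + 1) (by omega)
      rw [partialConcat_succ, hN n hn] at h1
      simpa using h1
    -- The first block multiplies to the value of `l`; each later block is a single empty factor, of
    -- value `1`.
    have hcut : IsCut (consSeq 0 fun k => N + k) := IsCut.of_cons fun a b hab => by simpa using hab
    have e := FinStarContKleeneOmegaAlgebra.prod_block (V := V) _ hf _ hcut.1 hcut.2.1 hcut.2.2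
    refine (e.trans (FinStarContKleeneOmegaAlgebra.prod_cons _ _)).trans
      (congrArg₂ _ ?_ (prod_congr (funext fun k => ?_) _ _))
    · exact (blockProd_evalWord h u N).trans (by rw [hN N le_rfl])
    · refine (blockProd_succ _ (N + k)).trans ?_
      rw [hnil _ (Nat.le_add_right N k), evalWord_nil]
  | inr s =>
    obtain ⟨h1, h2⟩ := hw
    have hget : ∀ n j (hj : j < (partialConcat u n).length),
        (partialConcat u n)[j] = s.get j := fun n j hj => by
      obtain ⟨t, ht⟩ := h1 n
      exact getElem_of_append_stream ht hj
    have hs : IsFinitary fun n => h (s.get n) := by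
      refine .of_finite (h '' B) (hB.image h) fun m => ⟨s.get m, ?_, rfl⟩
      obtain ⟨n, hn⟩ := h2 (m + 1)
      rw [← hget n m hn]
      exact mem_of_mem_partialConcat hu (List.getElem_mem _)
    -- Cutting the letters of `s` at these lengths recovers the factors `u n` as blocks.
    let i : ℕ → ℕ := fun n => (partialConcat u n).length
    have hi : ∀ n, i (n + 1) = i n + (u n).length := fun n => by
      simp only [i, partialConcat_succ, List.length_append]
    refine ⟨hs, ?_⟩
    rw [FinStarContKleeneOmegaAlgebra.prod_block _ hs i rfl
      (monotone_nat_of_le_succ fun n => by rw [hi]; exact Nat.le_add_right _ _) h2]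
    refine prod_congr (funext fun n => ?_) _ _
    rw [evalWord, blockProd]
    congr 1
    apply List.ext_getElem
    · simp [hi]
    · intro j hj1 hj2
      simp only [List.length_map] at hj1
      simp only [List.getElem_map, List.getElem_range', one_mul]
      have hlt : i n + j < (partialConcat u (n + 1)).length := by
        change _ < i (n + 1)
        rw [hi]
        omega
      rw [← hget (n + 1) _ hlt]
      congr 1
      simp [partialConcat_succ, i]

end WordValues

open FinitaryProd FinStarContKleeneOmegaAlgebra

/-! ### Dropping factors above `1`, and sums on the left of factors -/

section Algebra

variable {S : Type v} {V : Type w} [KleeneAlgebra S] [AddCommMonoid V]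
  [PartialOrder V] [Module S V] [FinitaryProd S V] [FinStarContKleeneOmegaAlgebra S V]

theorem IsFinitary.shift {x : ℕ → S} (hx : IsFinitary x) (n : ℕ) :
    IsFinitary fun k => x (k + n) := by
  obtain ⟨F, hF, h⟩ := hx
  exact ⟨F, hF, fun k => h (k + n)⟩

theorem prod_shift_eq {x : ℕ → S} (hx : IsFinitary x) (n : ℕ) :
    (prod _ (hx.shift n) : V) = x n • prod _ (hx.shift (n + 1)) := by
  rw [prod_cons, Nat.zero_add]
  exact congrArg _ (prod_congr (funext fun k => congrArg x (by omega)) _ _)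

theorem prod_shift_le {x : ℕ → S} (hx : IsFinitary x) {n : ℕ} (h : ∀ m < n, 1 ≤ x m) :
    (prod _ (hx.shift n) : V) ≤ prod x hx := by
  induction n with
  | zero => exact le_rfl
  | succ n ih =>
    refine le_trans ?_ (ih fun m hm => h m (by omega))
    rw [prod_shift_eq hx n]
    exact (one_smul S _).ge.trans (smul_le_smul_of_algebra (h n n.lt_succ_self) le_rfl)

theorem prod_zero_mul {x : ℕ → S} (hx : IsFinitary fun n => 0 * x n) :
    (prod _ hx : V) = 0 := by
  rw [prod_cons, zero_mul, zero_smul]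

/-- The axiom `prod_add` has the sum on the right of each factor. Shifting the grouping by half a
step, with a leading `1`, moves it to the left. -/
theorem isLUB_prod_add_mul {x : ℕ → S} (hx : IsFinitary x) (y z : S) :
    IsLUB
      (Set.range fun c : {c : ℕ → S // ∀ n, c n = y ∨ c n = z} =>
        (prod (fun n => c.1 n * x n) ((IsFinitary.of_pair c.2).mul hx) : V))
      (prod (fun n => (y + z) * x n) ((IsFinitary.const (y + z)).mul hx)) := by
  have key : ∀ c : ℕ → S, ∀ hc : IsFinitary c, (prod _ (hc.mul hx) : V) =
      prod _ ((hx.cons (x := 1)).mul hc) := fun c hc =>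
    prod_regroup (MonoidHom.id S) (regroup_shift hc hx) _ _
  rw [key _ (.const (y + z))]
  have := prod_add (V := V) (consSeq 1 x) hx.cons y z
  convert this using 3 with c
  exact key _ (.of_pair c.2)

end Algebra

/-! ### Removing a first letter from words and languages -/

section Words

variable {A : Type u}

theorem append_singleton_inj {a b : A} {w w' : InfWord A} (h : append [a] w = append [b] w') :
    a = b ∧ w = w' := by
  cases w with
  | inl l =>
    cases w' with
    | inl l' =>
      have := Sum.inl.inj h
      simpa using this
    | inr s => exact absurd h Sum.inl_ne_inr
  | inr s =>
    cases w' with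
    | inl l => exact absurd h Sum.inr_ne_inl
    | inr s' =>
      have := Sum.inr.inj h
      have h0 : a = b := congrArg (Stream'.get · 0) this
      subst h0
      exact ⟨rfl, congrArg _ (appendStream_cancel [a] this)⟩

theorem exists_isLimit_shift {u : ℕ → List A} {w : InfWord A} (hw : IsLimit (partialConcat u) w)
    (n : ℕ) : ∃ w', IsLimit (partialConcat fun k => u (k + n)) w' ∧
      append (partialConcat u n) w' = w := by
  induction n with
  | zero => exact ⟨w, hw, append_nil w⟩
  | succ n ih =>
    obtain ⟨w', hw', rfl⟩ := ih
    obtain ⟨w'', hw'', rfl⟩ := (isLimit_cons _ _).1 hw'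
    refine ⟨w'', ?_, ?_⟩
    · convert hw'' using 4
      omega
    · rw [partialConcat_succ, append_append, Nat.zero_add]

/-- Factors of an infinite concatenation starting with the letter `a`, split at the first nonempty
factor. -/
theorem exists_of_append_singleton_mem_infProd {X : ℕ → Language A} {a : A} {w : InfWord A}
    (hw : append [a] w ∈ infProd X) :
    ∃ n, (∀ m < n, [] ∈ X m) ∧ ∃ x, a :: x ∈ X n ∧
      ∃ w' ∈ infProd (fun k => X (k + (n + 1))), w = append x w' := by
  classical
  obtain ⟨u, hu, hw⟩ := hw
  -- If all factors were empty, the limit would be the empty word, which does not start with `a`.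
  have hne : ∃ n, u n ≠ [] := by
    by_contra! h
    have hnil : ∀ n, partialConcat u n = [] := fun n => by simp [partialConcat, h]
    cases w with
    | inl l =>
      obtain ⟨N, hN⟩ := hw
      have := hN N le_rfl
      rw [hnil] at this
      simp at this
    | inr s =>
      obtain ⟨n, hn⟩ := hw.2 1
      rw [hnil] at hn
      simp at hn
  have hlt : ∀ m < Nat.find hne, u m = [] := fun m hm => by
    simpa using Nat.find_min hne hm
  obtain ⟨w', hw', e⟩ := exists_isLimit_shift hw (Nat.find hne + 1)
  have h0 : partialConcat u (Nat.find hne) = [] := by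
    simp only [partialConcat, List.flatten_eq_nil_iff, List.mem_map, List.mem_range]
    rintro _ ⟨m, hm, rfl⟩
    exact hlt m hm
  obtain ⟨b, x, hx⟩ := List.exists_cons_of_ne_nil (Nat.find_spec hne)
  rw [partialConcat_succ, h0, List.nil_append, hx, ← List.singleton_append, append_append] at e
  obtain ⟨rfl, rfl⟩ := append_singleton_inj e
  exact ⟨Nat.find hne, fun m hm => hlt m hm ▸ hu m, x, hx ▸ hu _, w',
    ⟨_, fun k => hu _, hw'⟩, rfl⟩

/-- The Brzozowski derivative of an expression for `X` shows that the quotient is again regular. -/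
theorem exists_deriv (a : A) (X : RegLang A) :
    ∃ D : RegLang A, ∀ x, x ∈ D.1 ↔ a :: x ∈ X.1 := by
  classical
  obtain ⟨_, P, rfl⟩ := X
  refine ⟨⟨_, P.deriv a, rfl⟩, fun x => ?_⟩
  rw [← RegularExpression.rmatch_iff_matches', ← RegularExpression.rmatch_iff_matches']
  rfl

theorem one_le_regLang_iff {X : RegLang A} : 1 ≤ X ↔ [] ∈ X.1 :=
  ⟨fun h => h rfl, fun h _ hx => hx ▸ h⟩

end Words

/-! ### Finite sums of products paired with their values, and quotients -/

section Representation

variable {A : Type u} {S : Type v} [KleeneAlgebra S] {V : Type w} [AddCommMonoid V]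
  [PartialOrder V] [Module S V] [FinitaryProd S V] [FinStarContKleeneOmegaAlgebra S V]

/-- The product in `V` of the values of a finitary sequence of regular languages. -/
noncomputable def evalProd (h : A → S) (X : ℕ → RegLang A) (hX : IsFinitary X) : V :=
  prod (fun n => evalHom V h (X n)) (hX.map (evalHom V h : RegLang A →* S))

variable (V) in
/-- The pairs formed by a finite sum of infinite products of regular languages and its value. -/
def valuePairs (h : A → S) : AddSubmonoid (RegInf A × V) :=
  AddSubmonoid.closure {q | ∃ X, ∃ hX : IsFinitary X, q = (prod X hX, evalProd h X hX)}

theorem mem_valuePairs (h : A → S) {X : ℕ → RegLang A} (hX : IsFinitary X) :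
    (prod X hX, evalProd h X hX) ∈ valuePairs V h :=
  AddSubmonoid.subset_closure ⟨X, hX, rfl⟩

theorem evalProd_cons (h : A → S) {X : ℕ → RegLang A} (hX : IsFinitary X) :
    (evalProd h X hX : V) = evalHom V h (X 0) • evalProd h _ hX.tail :=
  prod_cons _ _

theorem evalProd_regroup (h : A → S) {X Y : ℕ → RegLang A} (hX : IsFinitary X)
    (hY : IsFinitary Y) (hXY : Regroup X Y) : (evalProd h X hX : V) = evalProd h Y hY :=
  prod_regroup (evalHom V h : RegLang A →* S) hXY _ _

theorem prod_regLang_regroup {X Y : ℕ → RegLang A} (hX : IsFinitary X)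
    (hY : IsFinitary Y) (hXY : Regroup X Y) : (prod X hX : RegInf A) = prod Y hY :=
  prod_regroup (MonoidHom.id (RegLang A)) hXY _ _

theorem smul_mem_valuePairs (h : A → S) (X : RegLang A) {q : RegInf A × V}
    (hq : q ∈ valuePairs V h) : (X • q.1, evalHom V h X • q.2) ∈ valuePairs V h := by
  induction hq using AddSubmonoid.closure_induction with
  | mem q hq =>
    obtain ⟨Y, hY, rfl⟩ := hq
    have := mem_valuePairs (V := V) h (hY.cons (x := X))
    rw [evalProd_cons, prod_cons] at this
    exact this
  | zero =>
    have : (X • (0 : RegInf A × V).1, evalHom V h X • (0 : RegInf A × V).2) = 0 :=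
      Prod.ext (smul_zero X) (smul_zero _)
    rw [this]
    exact zero_mem _
  | add q r _ _ hq hr =>
    simpa [smul_add] using add_mem hq hr

/-- Left quotients by a letter, up to words that are not needed here. -/
theorem exists_quotient_letter (h : A → S) (a : A) {q : RegInf A × V}
    (hq : q ∈ valuePairs V h) :
    ∃ r ∈ valuePairs V h, (∀ w, append [a] w ∈ q.1.1 → w ∈ r.1.1) ∧ h a • r.2 ≤ q.2 := by
  induction hq using AddSubmonoid.closure_induction with
  | zero => exact ⟨0, zero_mem _, fun w hw => hw, (smul_zero (h a)).le⟩
  | add q r _ _ hq hr =>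
    obtain ⟨q', hq', hqw, hqv⟩ := hq
    obtain ⟨r', hr', hrw, hrv⟩ := hr
    refine ⟨q' + r', add_mem hq' hr', fun w hw => hw.imp (hqw w) (hrw w), ?_⟩
    change h a • (q'.2 + r'.2) ≤ q.2 + r.2
    rw [smul_add]
    exact add_le_of_algebra S (hqv.trans (le_add_right_of_algebra S _ _))
      (hrv.trans (le_add_left_of_algebra S _ _))
  | mem q hq =>
    obtain ⟨X, hX, rfl⟩ := hq
    obtain ⟨F, hF, hXF⟩ := (isFinitary_iff X).1 hX
    obtain ⟨z, hzF, i, hi, hXz⟩ := exists_flatten hXF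
    have hz := isFinitary_of_mem_insert hF hzF
    have hreg : Regroup X z :=
      ⟨z, hz, i, _, hi, .of_id, hXz, funext fun k => (blockProd_succ z k).symm⟩
    rw [prod_regLang_regroup hX hz hreg, evalProd_regroup h hX hz hreg]
    choose D hD using exists_deriv (A := A) a
    -- The sum of the pieces `D (z n) · z (n + 1) ⋯` over those `n < N` whose earlier factors all
    -- contain the empty word. The value bound holds because `{a} · D (z n) ⊆ z n` and the earlier
    -- factors have values above `1`.
    have hpieces : ∀ N : ℕ, ∃ r ∈ valuePairs V h,
        (∀ n < N, (∀ m < n, 1 ≤ z m) →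
          act (D (z n)).1 (infProd fun k => (z (k + (n + 1))).1) ⊆ r.1.1) ∧
        h a • r.2 ≤ evalProd h z hz := by
      intro N
      induction N with
      | zero =>
        exact ⟨0, zero_mem _, fun n hn => absurd hn n.not_lt_zero,
          (smul_zero (h a)).le.trans (zero_le_of_algebra S _)⟩
      | succ N ih =>
        obtain ⟨r, hr, hrw, hrv⟩ := ih
        by_cases hN : ∀ m < N, 1 ≤ z m
        · refine ⟨r + (D (z N) • prod _ (hz.shift (N + 1)), _),
            add_mem hr (smul_mem_valuePairs h _ (mem_valuePairs h (hz.shift (N + 1)))), ?_, ?_⟩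
          · intro n hn hn1
            rcases Nat.lt_succ_iff_lt_or_eq.1 hn with hlt | rfl
            · exact (hrw n hlt hn1).trans Set.subset_union_left
            · exact Set.subset_union_right
          · refine (smul_add (h a) r.2 _).le.trans (add_le_of_algebra S hrv ?_)
            have h1 : (prod _ ((hz.map (evalHom V h : RegLang A →* S)).shift N) : V) ≤
                evalProd h z hz := prod_shift_le (hz.map (evalHom V h : RegLang A →* S)) fun m hm => by
              have := evalHom_mono (V := V) h (hN m hm)
              rwa [map_one] at this
            refine le_trans ?_ h1
            have h2 : RegLang.letter a * D (z N) ≤ z N := by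
              rintro _ ⟨x, hx, y, hy, rfl⟩
              rw [Set.mem_singleton_iff.1 hx]
              exact (hD _ _).1 hy
            have h3 := evalHom_mono (V := V) h h2
            rw [map_mul, evalHom_letter] at h3
            refine le_trans ?_ (prod_shift_eq (hz.map (evalHom V h : RegLang A →* S)) N).ge
            exact (mul_smul _ _ _).ge.trans
              (smul_le_smul_of_algebra h3 (le_refl (evalProd h _ (hz.shift (N + 1)))))
        · refine ⟨r, hr, fun n hn hn1 => ?_, hrv⟩
          rcases Nat.lt_succ_iff_lt_or_eq.1 hn with hlt | rfl
          · exact hrw n hlt hn1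
          · exact absurd hn1 hN
    -- Infinitely many `n` may contribute, but `z` takes finitely many values, so the first
    -- contributing index of each value suffices. The default `0` of `sInf` at values that never
    -- contribute is harmless.
    let first : RegLang A → ℕ := fun Y => sInf {n | z n = Y ∧ ∀ m < n, 1 ≤ z m}
    obtain ⟨N, hN⟩ := ((hF.insert 1).image first).bddAbove
    obtain ⟨r, hr, hrw, hrv⟩ := hpieces (N + 1)
    refine ⟨r, hr, fun w hw => ?_, hrv⟩
    obtain ⟨n, hn, x, hx, w', hw', rfl⟩ := exists_of_append_singleton_mem_infProd hw
    have hmem : n ∈ {k | z k = z n ∧ ∀ m < k, 1 ≤ z m} :=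
      ⟨rfl, fun m hm => one_le_regLang_iff.2 (hn m hm)⟩
    have hle : first (z n) ≤ n := Nat.sInf_le hmem
    obtain ⟨h1, h2⟩ := Nat.sInf_mem ⟨n, hmem⟩
    change z (first (z n)) = z n at h1
    change ∀ m < first (z n), _ at h2
    generalize hk : first (z n) = k at *
    have hkN : k ≤ N := hN ⟨z n, hzF n, hk⟩
    refine hrw k (by omega) h2 ⟨x, ?_, w', ?_, rfl⟩
    · rw [h1]
      exact (hD _ _).2 hx
    -- The factors at `k + 1, …, n` contain the empty word and can be dropped: those before `n` by
    -- the condition on `n`, and `z n` because it equals `z k` with `k < n`.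
    · have h3 := prod_shift_le (V := RegInf A) (hz.shift (k + 1)) (n := n - k) fun m hm => by
        rcases Nat.lt_or_ge (m + (k + 1)) n with h4 | h4
        · exact hmem.2 _ h4
        · rw [show m + (k + 1) = n by omega, ← h1]
          exact hmem.2 k (by omega)
      refine h3 ?_
      have h5 : ∀ l, l + (n - k) + (k + 1) = l + (n + 1) := fun l => by omega
      change w' ∈ infProd fun l => (z (l + (n - k) + (k + 1))).1
      simpa only [h5] using hw'

theorem exists_quotient_word (h : A → S) (x : List A) {q : RegInf A × V}
    (hq : q ∈ valuePairs V h) :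
    ∃ r ∈ valuePairs V h, (∀ w, append x w ∈ q.1.1 → w ∈ r.1.1) ∧
      evalWord h x • r.2 ≤ q.2 := by
  induction x generalizing q with
  | nil =>
    exact ⟨q, hq, fun w hw => append_nil w ▸ hw, by rw [evalWord_nil, one_smul]⟩
  | cons a x ih =>
    obtain ⟨r, hr, hrw, hrv⟩ := exists_quotient_letter h a hq
    obtain ⟨t, ht, htw, htv⟩ := ih hr
    refine ⟨t, ht, fun w hw => htw w (hrw _ ?_), ?_⟩
    · rw [← append_append]
      exact hw
    · rw [evalWord_cons, mul_smul]
      exact (smul_le_smul_of_algebra le_rfl htv).trans hrv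

end Representation

/-! ### Reduction to products of letters, and monotonicity of values -/

section Reduction

variable {A : Type u} {S : Type v} [KleeneAlgebra S] {V : Type w} [AddCommMonoid V]
  [PartialOrder V] [Module S V] [FinitaryProd S V] [FinStarContKleeneOmegaAlgebra S V]

variable (V) in
/-- Infinite products of terms `e * y n`, where the `y n` are products of elements of `F`, can be
reduced to infinite products of products of elements of `F`, both as sets of words and by taking a
supremum in `V`. -/
def Reduces (h : A → S) (F : Set (RegLang A)) (e : RegLang A) : Prop :=
  ∀ y : ℕ → RegLang A, (∀ n, y n ∈ Submonoid.closure F) →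
    ∀ hy : IsFinitary fun n => e * y n,
    ∃ T : Set {x : ℕ → RegLang A // IsFinitary x},
      (∀ x ∈ T, ∀ n, x.1 n ∈ Submonoid.closure F) ∧
      (∀ w, w ∈ infProd (fun n => (e * y n).1) ↔ ∃ x ∈ T, w ∈ infProd fun n => (x.1 n).1) ∧
      ∀ t : V, evalProd h _ hy ≤ t ↔ ∀ x ∈ T, evalProd h x.1 x.2 ≤ t

theorem reduces_zero (h : A → S) (F : Set (RegLang A)) : Reduces V h F 0 := by
  intro y _ hy
  refine ⟨∅, fun x hx => absurd hx (Set.notMem_empty x), fun w => ?_, fun t => ?_⟩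
  · have h1 : infProd (fun n => (0 * y n).1) = ∅ :=
      congrArg Subtype.val (prod_zero_mul (V := RegInf A) hy)
    rw [h1]
    exact ⟨fun hw => absurd hw (Set.notMem_empty w),
      fun ⟨x, hx, _⟩ => absurd hx (Set.notMem_empty x)⟩
  · have h1 : IsFinitary fun n => 0 * evalHom V h (y n) := by
      simpa only [zero_mul] using IsFinitary.const (0 : S)
    have h2 : (evalProd h _ hy : V) = 0 :=
      (prod_congr (by simp only [map_mul, map_zero]) _ h1).trans (prod_zero_mul h1)
    exact ⟨fun _ x hx => absurd hx (Set.notMem_empty x),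
      fun _ => h2.le.trans (zero_le_of_algebra S t)⟩

theorem isFinitary_of_mem_closure {M : Type*} [Monoid M] {F : Set M} (hF : F.Finite) {x : ℕ → M}
    (h : ∀ n, x n ∈ Submonoid.closure F) : IsFinitary x :=
  (isFinitary_iff x).2 ⟨F, hF, h⟩

/-- The family consists of all choices of exponents. It is exhaustive for words by choosing an
exponent at each position, and for values by the axiom `prod_star`. -/
theorem reduces_kstar (h : A → S) {F : Set (RegLang A)} (hF : F.Finite) {e : RegLang A}
    (he : e ∈ Submonoid.closure F) : Reduces V h F e∗ := by
  intro y hy hy'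
  have hyf := isFinitary_of_mem_closure hF hy
  refine ⟨Set.range fun k : ℕ → ℕ => ⟨fun n => e ^ k n * y n, (IsFinitary.powers e k).mul hyf⟩,
    ?_, fun w => ⟨fun hw => ?_, ?_⟩, fun t => ?_⟩
  · rintro _ ⟨k, rfl⟩ n
    exact mul_mem (pow_mem he _) (hy n)
  · obtain ⟨k, hk⟩ := mem_infProd_kstar_mul (X := e.1) (Y := fun n => (y n).1) hw
    exact ⟨_, ⟨k, rfl⟩, hk⟩
  · rintro ⟨_, ⟨k, rfl⟩, hw⟩
    exact infProd_mono (fun n => mul_le_mul_left (pow_le_kstar (a := e) (n := k n)) (y n)) hw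
  · have h1 := prod_star (V := V) (evalHom V h e) (fun n => evalHom V h (y n))
      (hyf.map (evalHom V h : RegLang A →* S))
    have h2 : (evalProd h _ hy' : V) = prod (fun n => (evalHom V h e)∗ * evalHom V h (y n))
        ((IsFinitary.const _).mul (hyf.map (evalHom V h : RegLang A →* S))) :=
      prod_congr (by simp only [map_mul, evalHom_kstar]) _ _
    rw [h2, isLUB_le_iff h1]
    simp only [mem_upperBounds, Set.forall_mem_range]
    refine forall_congr' fun k => ?_
    rw [evalProd]
    simp only [map_mul, map_pow]

theorem reduces_add (h : A → S) {F : Set (RegLang A)} (hF : F.Finite) {e f : RegLang A}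
    (he : e ∈ Submonoid.closure F) (hf : f ∈ Submonoid.closure F) : Reduces V h F (e + f) := by
  intro y hy hy'
  have hyf := isFinitary_of_mem_closure hF hy
  refine ⟨Set.range fun c : {c : ℕ → RegLang A // ∀ n, c n = e ∨ c n = f} =>
    ⟨fun n => c.1 n * y n, (IsFinitary.of_pair c.2).mul hyf⟩,
    ?_, fun w => ⟨fun hw => ?_, ?_⟩, fun t => ?_⟩
  · rintro _ ⟨c, rfl⟩ n
    refine mul_mem ?_ (hy n)
    rcases c.2 n with h | h <;> rw [h] <;> assumption
  · obtain ⟨c, hc⟩ := mem_infProd_add (Y := fun n => (e * y n).1) (Z := fun n => (f * y n).1)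
      (infProd_mono (fun n => (add_mul e.1 f.1 (y n).1).le) hw)
    refine ⟨_, ⟨⟨fun n => cond (c n) e f, fun n => ?_⟩, rfl⟩, ?_⟩
    · cases h : c n <;> simp [h]
    · refine infProd_mono (fun n => ?_) hc
      change _ ≤ (cond (c n) e f * y n).1
      cases c n <;> rfl
  · rintro ⟨_, ⟨c, rfl⟩, hw⟩
    refine infProd_mono (fun n => ?_) hw
    change c.1 n * y n ≤ (e + f) * y n
    refine mul_le_mul_left ?_ _
    rcases c.2 n with h | h <;> rw [h]
    · exact le_sup_left (a := e) (b := f)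
    · exact le_sup_right (a := e) (b := f)
  · have hyg : IsFinitary fun n => evalHom V h (y n) := hyf.map (evalHom V h : RegLang A →* S)
    have h1 := isLUB_prod_add_mul (V := V) hyg (evalHom V h e) (evalHom V h f)
    have h2 : (evalProd h _ hy' : V) =
        prod (fun n => (evalHom V h e + evalHom V h f) * evalHom V h (y n))
          ((IsFinitary.const _).mul hyg) :=
      prod_congr (by simp only [map_mul, map_add]) _ _
    rw [h2, isLUB_le_iff h1]
    simp only [mem_upperBounds, Set.forall_mem_range]
    constructor
    · intro H c
      refine le_of_eq_of_le ?_
        (H ⟨fun n => evalHom V h (c.1 n), fun n => (c.2 n).imp (congrArg _) (congrArg _)⟩)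
      exact prod_congr (by simp only [map_mul]) _ _
    · intro H c
      classical
      -- The axiom ranges over sequences of values and the family over sequences of languages. Any
      -- lift of `c` will do, even if `e` and `f` have the same value.
      let c' : ℕ → RegLang A := fun n => if c.1 n = evalHom V h e then e else f
      have hc : ∀ n, evalHom V h (c' n) = c.1 n := fun n => by
        simp only [c']
        split_ifs with h3
        · exact h3.symm
        · exact ((c.2 n).resolve_left h3).symm
      refine le_of_eq_of_le ?_ (H ⟨c', fun n => ?_⟩)
      · exact prod_congr (by simp only [map_mul, hc]) _ _
      · simp only [c']
        split_ifs <;> simp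

variable (V) in
/-- Sets of regular languages built from finitely many letters by adding reducible elements. -/
inductive Reducible (h : A → S) : Set (RegLang A) → Prop
  | letters {B : Set A} (hB : B.Finite) : Reducible h (RegLang.letter '' B)
  | step {F : Set (RegLang A)} {e : RegLang A} (hF : Reducible h F) (he : Reduces V h F e) :
    Reducible h (insert e F)

theorem Reducible.finite {h : A → S} {F : Set (RegLang A)} (hF : Reducible V h F) : F.Finite := by
  induction hF with
  | letters hB => exact hB.image _
  | step _ _ ih => exact ih.insert _

variable (V) in
-- Starting from an arbitrary `F` lets subexpressions be handled in succession, each enlarging the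
-- set reached so far. The letters must be there at the outset, as `Reducible` introduces them only
-- at its base. Concatenation needs no new generator.
theorem exists_reducible_of_regular (h : A → S) (X : RegLang A) :
    ∃ B : Set A, B.Finite ∧ ∀ F, Reducible V h F → RegLang.letter '' B ⊆ F →
      ∃ G, Reducible V h G ∧ F ⊆ G ∧ X ∈ Submonoid.closure G := by
  obtain ⟨_, P, rfl⟩ := X
  induction P with
  | zero =>
    exact ⟨∅, Set.finite_empty, fun F hF _ => ⟨_, hF.step (reduces_zero h F),
      Set.subset_insert _ _, Submonoid.subset_closure (.inl rfl)⟩⟩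
  | epsilon => exact ⟨∅, Set.finite_empty, fun F hF _ => ⟨F, hF, subset_rfl, one_mem _⟩⟩
  | char a =>
    exact ⟨{a}, Set.finite_singleton a, fun F hF hB =>
      ⟨F, hF, subset_rfl, Submonoid.subset_closure (hB ⟨a, rfl, rfl⟩)⟩⟩
  | plus P Q hP hQ =>
    obtain ⟨B, hB, hP⟩ := hP
    obtain ⟨C, hC, hQ⟩ := hQ
    refine ⟨B ∪ C, hB.union hC, fun F hF hBC => ?_⟩
    rw [Set.image_union, Set.union_subset_iff] at hBC
    obtain ⟨G, hG, hFG, hPG⟩ := hP F hF hBC.1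
    obtain ⟨K, hK, hGK, hQK⟩ := hQ G hG (hBC.2.trans hFG)
    exact ⟨_, hK.step (reduces_add h hK.finite (Submonoid.closure_mono hGK hPG) hQK),
      (hFG.trans hGK).trans (Set.subset_insert _ _), Submonoid.subset_closure (.inl rfl)⟩
  | comp P Q hP hQ =>
    obtain ⟨B, hB, hP⟩ := hP
    obtain ⟨C, hC, hQ⟩ := hQ
    refine ⟨B ∪ C, hB.union hC, fun F hF hBC => ?_⟩
    rw [Set.image_union, Set.union_subset_iff] at hBC
    obtain ⟨G, hG, hFG, hPG⟩ := hP F hF hBC.1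
    obtain ⟨K, hK, hGK, hQK⟩ := hQ G hG (hBC.2.trans hFG)
    exact ⟨K, hK, hFG.trans hGK, mul_mem (Submonoid.closure_mono hGK hPG) hQK⟩
  | star P hP =>
    obtain ⟨B, hB, hP⟩ := hP
    refine ⟨B, hB, fun F hF hBF => ?_⟩
    obtain ⟨G, hG, hFG, hPG⟩ := hP F hF hBF
    exact ⟨_, hG.step (reduces_kstar h hG.finite hPG), hFG.trans (Set.subset_insert _ _),
      Submonoid.subset_closure (.inl rfl)⟩

variable (V) in
theorem exists_reducible (h : A → S) {K : Set (RegLang A)} (hK : K.Finite) :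
    ∃ F, Reducible V h F ∧ K ⊆ Submonoid.closure F := by
  have key : ∃ B : Set A, B.Finite ∧ ∀ F, Reducible V h F → RegLang.letter '' B ⊆ F →
      ∃ G, Reducible V h G ∧ F ⊆ G ∧ K ⊆ Submonoid.closure G := by
    induction K, hK using Set.Finite.induction_on with
    | empty => exact ⟨∅, Set.finite_empty, fun F hF _ => ⟨F, hF, subset_rfl, Set.empty_subset _⟩⟩
    | @insert X K _ _ ih =>
      obtain ⟨B, hB, hX⟩ := exists_reducible_of_regular V h X
      obtain ⟨C, hC, hK⟩ := ih
      refine ⟨B ∪ C, hB.union hC, fun F hF hBC => ?_⟩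
      rw [Set.image_union, Set.union_subset_iff] at hBC
      obtain ⟨G, hG, hFG, hXG⟩ := hX F hF hBC.1
      obtain ⟨L, hL, hGL, hKL⟩ := hK G hG (hBC.2.trans hFG)
      exact ⟨L, hL, hFG.trans hGL,
        Set.insert_subset (Submonoid.closure_mono hGL hXG) hKL⟩
  obtain ⟨B, hB, hG⟩ := key
  obtain ⟨G, hG, -, hKG⟩ := hG _ (.letters hB) subset_rfl
  exact ⟨G, hG, hKG⟩

theorem exists_reducible_of_isFinitary (h : A → S) {X : ℕ → RegLang A} (hX : IsFinitary X) :
    ∃ F, Reducible V h F ∧ ∀ n, X n ∈ Submonoid.closure F := by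
  obtain ⟨K, hK, hXK⟩ := (isFinitary_iff X).1 hX
  obtain ⟨F, hF, hKF⟩ := exists_reducible V h hK
  exact ⟨F, hF, fun n => Submonoid.closure_le.2 hKF (hXK n)⟩

theorem exists_word_of_mem_closure {B : Set A} {X : RegLang A}
    (hX : X ∈ Submonoid.closure (RegLang.letter '' B)) :
    ∃ x : List A, (∀ a ∈ x, a ∈ B) ∧ X.1 = ({x} : Language A) := by
  induction hX using Submonoid.closure_induction with
  | mem _ h =>
    obtain ⟨a, ha, rfl⟩ := h
    exact ⟨[a], by simpa using ha, rfl⟩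
  | one => exact ⟨[], by simp, rfl⟩
  | mul X Y _ _ hX hY =>
    obtain ⟨x, hx, hX⟩ := hX
    obtain ⟨y, hy, hY⟩ := hY
    refine ⟨x ++ y, by simpa [or_imp, forall_and] using ⟨hx, hy⟩, ?_⟩
    change X.1 * Y.1 = _
    rw [hX, hY]
    exact Set.image2_singleton

/-- The value of a sequence of one-word languages. -/
theorem evalProd_words (h : A → S) {B : Set A} (hB : B.Finite) {X : ℕ → RegLang A}
    (hX : IsFinitary X) {u : ℕ → List A} (hu : ∀ n, ∀ a ∈ u n, a ∈ B)
    (huX : ∀ n, (X n).1 = ({u n} : Language A)) {w : InfWord A}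
    (hw : IsLimit (partialConcat u) w) : IsWordValue h w (evalProd h X hX : V) := by
  have h1 := isWordValue_prod (V := V) h hB hu hw (isFinitary_evalWord h hB hu)
  convert h1 using 1
  refine prod_congr (funext fun n => ?_) _ _
  refine (isLangSup_evalHom h (X n)).unique (V := V) ?_
  rw [huX]
  exact .singleton _

theorem prod_eq_smul_of_regroup (h : A → S) {p : RegLang A} {X Y : ℕ → RegLang A}
    (hX : IsFinitary X) (hY : IsFinitary Y) (hXY : Regroup X (consSeq p Y)) :
    (prod X hX : RegInf A) = p • prod Y hY ∧
      (evalProd h X hX : V) = evalHom V h p • evalProd h Y hY := by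
  rw [prod_regLang_regroup hX hY.cons hXY, evalProd_regroup h hX hY.cons hXY, prod_cons,
    evalProd_cons]
  exact ⟨rfl, rfl⟩

/-- Splitting the word as `x w'` with `x` in `p`, its value is that of `x` acting on that of `w'`,
so monotonicity of the action is enough. -/
theorem le_smul_of_mem_act (h : A → S) {p : RegLang A} {Y : ℕ → RegLang A} (hY : IsFinitary Y)
    (H : ∀ w ∈ infProd fun n => (Y n).1, ∀ v : V, IsWordValue h w v → v ≤ evalProd h Y hY)
    {w : InfWord A} (hw : w ∈ act p.1 (infProd fun n => (Y n).1)) {v : V}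
    (hv : IsWordValue h w v) : v ≤ evalHom V h p • evalProd h Y hY := by
  obtain ⟨x, hx, w', hw', rfl⟩ := hw
  obtain ⟨v', hv', rfl⟩ := exists_isWordValue_of_append x hv
  exact smul_le_smul_of_algebra (evalWord_le_evalHom h hx) (H w' hw' v' hv')

/-- The values of the words in an infinite product are below the value of the product. -/
theorem Reducible.le_evalProd {h : A → S} {F : Set (RegLang A)} (hF : Reducible V h F)
    {X : ℕ → RegLang A} (hX : IsFinitary X) (hXF : ∀ n, X n ∈ Submonoid.closure F)
    {w : InfWord A} (hw : w ∈ infProd fun n => (X n).1) {v : V} (hv : IsWordValue h w v) :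
    v ≤ evalProd h X hX := by
  induction hF generalizing X w v with
  | letters hB =>
    choose u huB huX using fun n => exists_word_of_mem_closure (hXF n)
    obtain ⟨u', hu', hw⟩ := hw
    have : u' = u := funext fun n => by
      have := hu' n
      dsimp only at this
      rwa [huX] at this
    subst this
    exact (hv.unique (evalProd_words h hB hX huB huX hw)).le
  | @step F e hF he ih =>
    obtain ⟨p, y, hyF, hreg⟩ := exists_regroup_insert hF.finite e hXF
    have hy := isFinitary_of_mem_closure hF.finite hyF
    have hey : IsFinitary fun n => e * y n := (IsFinitary.const e).mul hy
    rcases hreg with hreg | hreg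
    · obtain ⟨h1, h2⟩ := prod_eq_smul_of_regroup (V := V) h hX hy hreg
      rw [h2]
      exact le_smul_of_mem_act h hy (fun w hw v hv => ih hy hyF hw hv)
        ((congrArg Subtype.val h1).le hw) hv
    · obtain ⟨h1, h2⟩ := prod_eq_smul_of_regroup (V := V) h hX hey hreg
      rw [h2]
      refine le_smul_of_mem_act h hey (fun w hw v hv => ?_) ((congrArg Subtype.val h1).le hw) hv
      obtain ⟨T, hTF, hTw, hT⟩ := he y hyF hey
      -- The word lies in one product of the reducing family, whose value is below that of the
      -- whole.
      obtain ⟨x, hx, hwx⟩ := (hTw w).1 hw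
      exact (ih x.2 (hTF x hx) hwx hv).trans ((hT _).1 le_rfl x hx)

theorem le_of_mem_valuePairs (h : A → S) {q : RegInf A × V} (hq : q ∈ valuePairs V h)
    {w : InfWord A} (hw : w ∈ q.1.1) {v : V} (hv : IsWordValue h w v) : v ≤ q.2 := by
  induction hq using AddSubmonoid.closure_induction with
  | mem q hq =>
    obtain ⟨X, hX, rfl⟩ := hq
    obtain ⟨F, hF, hXF⟩ := exists_reducible_of_isFinitary (V := V) h hX
    exact hF.le_evalProd hX hXF hw hv
  | zero => exact absurd hw (Set.notMem_empty w)
  | add q r _ _ hq hr =>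
    rcases hw with hw | hw
    · exact (hq hw).trans (le_add_right_of_algebra S _ _)
    · exact (hr hw).trans (le_add_left_of_algebra S _ _)

/-- The hypothesis is applied to the quotients of `q` by the words of `p`, and so must hold for all
pairs, not just for `q`. No suprema in `V` have to be preserved by the action. -/
theorem smul_le_of_act_subset (h : A → S) {p : RegLang A} {Y : ℕ → RegLang A} (hY : IsFinitary Y)
    (H : ∀ q ∈ valuePairs V h, infProd (fun n => (Y n).1) ⊆ q.1.1 → evalProd h Y hY ≤ q.2)
    {q : RegInf A × V} (hq : q ∈ valuePairs V h)
    (hle : act p.1 (infProd fun n => (Y n).1) ⊆ q.1.1) :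
    evalHom V h p • evalProd h Y hY ≤ q.2 := by
  rw [(isLangSup_evalHom h p).smul_le_iff]
  intro x hx
  obtain ⟨r, hr, hrw, hrv⟩ := exists_quotient_word h x hq
  exact (smul_le_smul_of_algebra le_rfl
    (H r hr fun w hw => hrw w (hle ⟨x, hx, w, hw, rfl⟩))).trans hrv

/-- The value of an infinite product is below the value of every finite sum of infinite products
that contains it. -/
theorem Reducible.evalProd_le {h : A → S} {F : Set (RegLang A)} (hF : Reducible V h F)
    {X : ℕ → RegLang A} (hX : IsFinitary X) (hXF : ∀ n, X n ∈ Submonoid.closure F)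
    {q : RegInf A × V} (hq : q ∈ valuePairs V h)
    (hle : infProd (fun n => (X n).1) ⊆ q.1.1) : evalProd h X hX ≤ q.2 := by
  induction hF generalizing X q with
  | letters hB =>
    choose u huB huX using fun n => exists_word_of_mem_closure (hXF n)
    obtain ⟨w, hw⟩ := exists_isLimit u
    -- The value of this product of one-word languages is the value of the word `w`, which lies in
    -- the target.
    refine le_of_mem_valuePairs h hq (hle ⟨u, fun n => ?_, hw⟩)
      (evalProd_words h hB hX huB huX hw)
    dsimp only
    rw [huX]
    rfl
  | @step F e hF he ih =>
    obtain ⟨p, y, hyF, hreg⟩ := exists_regroup_insert hF.finite e hXF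
    have hy := isFinitary_of_mem_closure hF.finite hyF
    have hey : IsFinitary fun n => e * y n := (IsFinitary.const e).mul hy
    rcases hreg with hreg | hreg
    · obtain ⟨h1, h2⟩ := prod_eq_smul_of_regroup (V := V) h hX hy hreg
      rw [h2]
      exact smul_le_of_act_subset h hy (fun q hq hle => ih hy hyF hq hle) hq
        ((congrArg Subtype.val h1).ge.trans hle)
    · obtain ⟨h1, h2⟩ := prod_eq_smul_of_regroup (V := V) h hX hey hreg
      rw [h2]
      refine smul_le_of_act_subset h hey (fun q hq hle => ?_) hq
        ((congrArg Subtype.val h1).ge.trans hle)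
      obtain ⟨T, hTF, hTw, hT⟩ := he y hyF hey
      exact (hT _).2 fun x hx =>
        ih x.2 (hTF x hx) hq fun w hw => hle ((hTw w).2 ⟨x, hx, hw⟩)

theorem valuePairs_mono (h : A → S) {q r : RegInf A × V} (hq : q ∈ valuePairs V h)
    (hr : r ∈ valuePairs V h) (hle : q.1 ≤ r.1) : q.2 ≤ r.2 := by
  induction hq using AddSubmonoid.closure_induction with
  | mem q hq =>
    obtain ⟨X, hX, rfl⟩ := hq
    obtain ⟨F, hF, hXF⟩ := exists_reducible_of_isFinitary (V := V) h hX
    exact hF.evalProd_le hX hXF hr hle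
  | zero => exact zero_le_of_algebra S _
  | add q q' _ _ hq hq' =>
    exact add_le_of_algebra S (hq ((le_add_right_of_algebra (RegLang A) _ _).trans hle))
      (hq' ((le_add_left_of_algebra (RegLang A) _ _).trans hle))

theorem coe_sum_regInf {ι : Type*} (s : Finset ι) (f : ι → RegInf A) :
    (∑ j ∈ s, f j).1 = ⋃ j ∈ s, (f j).1 := by
  classical
  induction s using Finset.induction_on with
  | empty =>
    rw [Finset.sum_empty]
    simp only [Finset.notMem_empty, Set.iUnion_of_empty, Set.iUnion_empty]
    rfl
  | insert j s hj ih =>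
    rw [Finset.sum_insert hj, Finset.set_biUnion_insert, ← ih]
    rfl

variable (V) in
theorem exists_mem_valuePairs (h : A → S) (Y : RegInf A) : ∃ v, (Y, v) ∈ valuePairs V h := by
  obtain ⟨_, k, R, hR, hfin, rfl⟩ := Y
  let X : Fin k → ℕ → RegLang A := fun j n => ⟨R j n, hR j n⟩
  have hX : ∀ j, IsFinitary (X j) := fun j =>
    .of_finite _ ((hfin j).preimage Subtype.val_injective.injOn) fun n => ⟨n, rfl⟩
  have := sum_mem fun j (_ : j ∈ Finset.univ) => mem_valuePairs (V := V) h (hX j)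
  have h1 : (∑ j, (prod (X j) (hX j), evalProd h (X j) (hX j)) : RegInf A × V).1 =
      ⟨⋃ j, infProd (R j), k, R, hR, hfin, rfl⟩ := by
    refine Subtype.ext ?_
    rw [Prod.fst_sum, coe_sum_regInf]
    simp only [Finset.mem_univ, Set.iUnion_true]
    rfl
  rw [← h1]
  exact ⟨_, this⟩

end Reduction

/-! ### The extension to a homomorphism and its uniqueness -/

section Universal

variable {A : Type u} {S : Type v} [KleeneAlgebra S] {V : Type w} [AddCommMonoid V]
  [PartialOrder V] [Module S V] [FinitaryProd S V] [FinStarContKleeneOmegaAlgebra S V]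

variable (V) in
/-- The value of an element of `R'(A^∞)`. -/
noncomputable def evalInf (h : A → S) (Y : RegInf A) : V :=
  Classical.choose (exists_mem_valuePairs V h Y)

/-- Monotonicity in both directions makes the relation `valuePairs` a function. Each homomorphism
law then reduces to a closure property of `valuePairs`. -/
theorem evalInf_eq (h : A → S) {Y : RegInf A} {v : V} (hv : (Y, v) ∈ valuePairs V h) :
    evalInf V h Y = v :=
  have hY := Classical.choose_spec (exists_mem_valuePairs V h Y)
  le_antisymm (valuePairs_mono h hY hv le_rfl) (valuePairs_mono h hv hY le_rfl)

theorem evalInf_mem (h : A → S) (Y : RegInf A) : (Y, evalInf V h Y) ∈ valuePairs V h :=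
  Classical.choose_spec (exists_mem_valuePairs V h Y)

variable (V) in
/-- The homomorphism extending a valuation of the letters. -/
noncomputable def extension (h : A → S) : Hom (RegLang A) (RegInf A) S V where
  onS := evalHom V h
  onV :=
    { toFun := evalInf V h
      map_zero' := evalInf_eq h (zero_mem _)
      map_add' := fun Y Z => evalInf_eq h (add_mem (evalInf_mem h Y) (evalInf_mem h Z)) }
  map_kstar := evalHom_kstar h
  map_smul X Y := evalInf_eq h (smul_mem_valuePairs h X (evalInf_mem h Y))
  map_prod _ hX := evalInf_eq h (mem_valuePairs h hX)

theorem eq_extension {h : A → S} {φ : Hom (RegLang A) (RegInf A) S V}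
    (hφ : ∀ a, φ.onS (RegLang.letter a) = h a) : φ = extension V h := by
  have hS : φ.onS = evalHom V h := ringHom_ext_of_letter φ.map_kstar (evalHom_kstar h)
    fun a => (hφ a).trans (evalHom_letter h a).symm
  -- The pairs are generated additively by infinite products, where preservation of products and
  -- `hS` force the value of `φ.onV`.
  have hpair : ∀ q ∈ valuePairs V h, φ.onV q.1 = q.2 := fun q hq => by
    induction hq using AddSubmonoid.closure_induction with
    | mem q hq =>
      obtain ⟨X, hX, rfl⟩ := hq
      exact (φ.map_prod X hX).trans (prod_congr (by rw [hS]) _ _)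
    | zero => exact map_zero _
    | add q r _ _ hq hr => exact (map_add _ _ _).trans (congrArg₂ _ hq hr)
  have hV : φ.onV = (extension V h).onV :=
    AddMonoidHom.ext fun Y => hpair _ (evalInf_mem h Y)
  obtain ⟨f, g, _, _, _⟩ := φ
  change f = (extension V h).onS at hS
  subst hS hV
  rfl

end Universal

end KleeneOmega

theorem mainTheorem4 (A : Type*) :
    KleeneOmega.FinStarContKleeneOmegaAlgebra (KleeneOmega.RegLang A) (KleeneOmega.RegInf A) ∧
    ∀ (S : Type*) (V : Type*) [KleeneAlgebra S] [AddCommMonoid V] [PartialOrder V]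
      [Module S V] [KleeneOmega.FinitaryProd S V]
      [KleeneOmega.FinStarContKleeneOmegaAlgebra S V] (h : A → S),
      ∃! φ : KleeneOmega.Hom (KleeneOmega.RegLang A) (KleeneOmega.RegInf A) S V,
        ∀ a : A, φ.onS (KleeneOmega.RegLang.letter a) = h a :=
  ⟨KleeneOmega.instAlgebraRegLang, fun _ V _ _ _ _ _ _ h =>
    ⟨KleeneOmega.extension V h, KleeneOmega.evalHom_letter h,
      fun _ hφ => KleeneOmega.eq_extension hφ⟩⟩
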